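/- **Notation.** For $a\in[0,1]$, $R\in[-1,1]$ and $w>0$ put $$K(w)=\Big[1-\frac{2w(R+1)}{(w+1)^2}\Big]^{1/2},\qquad T_1(w)=\frac{w+1}{w}\Big[1-\frac a2\,(1-K(w))\Big],$$ $$T_2(w)=\Big[1-\frac a2(1-K(w))-\frac{a(R+1)(1-w)}{2K(w)(w+1)^2}\Big]\Big[\frac1{w^2}-\frac{a}{2w^2}(1-K(w))-\frac{a(R+1)(w-1)}{2wK(w)(w+1)^2}\Big],$$ $$T_3(w)=a\Big[\frac{R+1}{K(w)(w+1)^3}-\frac{(R+1)^2(w-1)^2}{2K(w)^3(w+1)^5}\Big],$$ $$V_{a,R}(x_1,x_2)=\Big(\frac1{x_1}+\frac1{x_2}\Big)\Big[1-\frac a2\Big(1-\sqrt{1-2(R+1)\tfrac{x_1x_2}{(x_1+x_2)^2}}\Big)\Big],\quad x_1,x_2>0.$$ Let $0<\nu<1/2$, let $X=\{X(s),s\in\mathbb R^d\}$ be a real random field, and let $s,h\in\mathbb R^d$. We say that *the covariance formula holds with $(a,R)$* if $|X(s)|^\nu$ and $|X(s+h)|^\nu$ are square integrable, the following integral converges absolutely,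 and $$\mathrm{Cov}\big(|X(s)|^\nu,|X(s+h)|^\nu\big)=\int_0^\infty w^\nu\Big[\Gamma(2(1-\nu))\,T_2(w)\,T_1(w)^{2(\nu-1)}+\Gamma(1-2\nu)\,T_3(w)\,T_1(w)^{2\nu-1}\Big]\,dw-\Gamma(1-\nu)^2 .$$ **Corollary 4.3.** (i) Let $r>0$, $\alpha(h)=\{1-\|h\|/(2r)\}_+$ and let $\rho(h)\in[-1,1]$, with $\rho(h)<1$ unless $\alpha(h)=0$. If the pair $(X(s),X(s+h))$ has the law of the truncated extremal Gaussian (TEG) model with correlation $\rho$ and truncation parameter $r$, that is, $\mathbb P(X(s)\le x_1,X(s+h)\le x_2)=\exp(-V_{\alpha(h),\rho(h)}(x_1,x_2))$ for all $x_1,x_2>0$, then the covariance formula holds with $(\alpha(h),\rho(h))$. (ii) Let $X$ be the TEG max-stable process with unit Fréchet margins and spectral representation: for every $s$, almost surely, $$X(s)=\frac{\sqrt{2\pi}}{\mathbb E|B|}\,\sup_{i}\ \xi_i\,\max(W_i(s),0)\,\mathbf 1_{B_i}(s-c_i),$$ where $\{(\xi_i,c_i)\}$ is a Poisson point process on $(0,\infty)\times\mathbb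 R^d$ with intensity $\xi^{-2}\,d\xi\,dc$, the $W_i$ are i.i.d. centred stationary Gaussian processes with unit variance and correlation function $\rho$ (a function of the lag), the $B_i$ are i.i.d. copies of a random compact set $B$ with $0<\mathbb E|B|<\infty$ ($|\cdot|$ is Lebesgue measure), and the points, the $W_i$ and the $B_i$ are independent of one another. Put $\alpha(h)=\mathbb E|B\cap(h+B)|/\mathbb E|B|$. Then $\mathbb P(X(s)\le x_1,X(s+h)\le x_2)=\exp(-V_{\alpha(h),\rho(h)}(x_1,x_2))$ for all $x_1,x_2>0$, and, if $\rho(h)<1$ or $\alpha(h)=0$, the covariance formula holds with $(\alpha(h),\rho(h))$. If $d=1$ and $B=[-r,r]$ almost surely, then $\alpha(h)=\{1-|h|/(2r)\}_+$. -/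

import Mathlib

open MeasureTheory ProbabilityTheory Set
open scoped ENNReal Nat

noncomputable section

/-! ### The explicit functions in the covariance formula

`a` stands for the value `α(h)`, and `R` for the value `ρ(h)`. -/

/-- `K(w) = [1 - 2 w (R + 1) / (w + 1)²]^{1/2}`. -/
def tegK (R w : ℝ) : ℝ :=
  √(1 - 2 * w * (R + 1) / (w + 1) ^ 2)

def tegT1 (a R w : ℝ) : ℝ :=
  (w + 1) / w * (1 - a / 2 * (1 - tegK R w))

def tegT2 (a R w : ℝ) : ℝ :=
  (1 - a / 2 * (1 - tegK R w)
      - a * (R + 1) * (1 - w) / (2 * tegK R w * (w + 1) ^ 2)) *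
    (1 / w ^ 2 - a / (2 * w ^ 2) * (1 - tegK R w)
      - a * (R + 1) * (w - 1) / (2 * w * tegK R w * (w + 1) ^ 2))

def tegT3 (a R w : ℝ) : ℝ :=
  a * ((R + 1) / (tegK R w * (w + 1) ^ 3)
    - (R + 1) ^ 2 * (w - 1) ^ 2 / (2 * tegK R w ^ 3 * (w + 1) ^ 5))

/-- The integrand of the covariance formula. -/
def tegIntegrand (a R ν w : ℝ) : ℝ :=
  w ^ ν * (Real.Gamma (2 * (1 - ν)) * tegT2 a R w * tegT1 a R w ^ (2 * (ν - 1))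
    + Real.Gamma (1 - 2 * ν) * tegT3 a R w * tegT1 a R w ^ (2 * ν - 1))

/-- The truncation profile `{1 - t / (2 r)}₊`. -/
def truncProfile (r t : ℝ) : ℝ := max (1 - t / (2 * r)) 0

/-! ### Bivariate laws -/

/-- The exponent measure function of the truncated extremal Gaussian model. -/
def tegExponent (a R x₁ x₂ : ℝ) : ℝ :=
  (1 / x₁ + 1 / x₂) *
    (1 - a / 2 * (1 - √(1 - 2 * (R + 1) * (x₁ * x₂ / (x₁ + x₂) ^ 2))))

/-- The pair `(Y, Z)` has the joint distribution function `exp (-V)` on `(0, ∞)²`, where `V` is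
the exponent measure function of the truncated extremal Gaussian model.  (Letting one argument
tend to infinity shows that the margins are unit Fréchet.) -/
structure HasTEGPairLaw {Ω : Type*} [MeasurableSpace Ω] (P : Measure Ω) (Y Z : Ω → ℝ)
    (a R : ℝ) : Prop where
  aemeasurable_fst : AEMeasurable Y P
  aemeasurable_snd : AEMeasurable Z P
  cdf : ∀ x₁ x₂ : ℝ, 0 < x₁ → 0 < x₂ →
    P {ω | Y ω ≤ x₁ ∧ Z ω ≤ x₂} = ENNReal.ofReal (Real.exp (-tegExponent a R x₁ x₂))

/-- The damage variables `|Y|^ν` and `|Z|^ν` are square integrable (so that their covariance is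
well defined), the integral in the formula converges absolutely, and the covariance is given by
the formula. -/
structure HasTEGCovariance {Ω : Type*} [MeasurableSpace Ω] (P : Measure Ω) (Y Z : Ω → ℝ)
    (a R ν : ℝ) : Prop where
  memLp_fst : MemLp (fun ω => |Y ω| ^ ν) 2 P
  memLp_snd : MemLp (fun ω => |Z ω| ^ ν) 2 P
  integrableOn : IntegrableOn (tegIntegrand a R ν) (Ioi 0)
  covariance_eq :
    covariance (fun ω => |Y ω| ^ ν) (fun ω => |Z ω| ^ ν) P =
      (∫ w in Ioi (0 : ℝ), tegIntegrand a R ν w) - Real.Gamma (1 - ν) ^ 2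

/-! ### Poisson point processes -/

/-- The number of points of the sequence `p` that lie in `A`. -/
def pointCount {Ω F : Type*} (p : ℕ → Ω → F) (A : Set F) (ω : Ω) : ℕ∞ :=
  {i | p i ω ∈ A}.encard

/-- The random points `p 0, p 1, …` form a Poisson point process with intensity measure `Λ`
(where `Λ` has infinite total mass). -/
structure IsPoissonPointProcess {Ω F : Type*} [MeasurableSpace Ω] [MeasurableSpace F]
    (P : Measure Ω) (p : ℕ → Ω → F) (Λ : Measure F) : Prop where
  measurable : ∀ i, Measurable (p i)
  poisson : ∀ A, MeasurableSet A → Λ A ≠ ∞ → ∀ k : ℕ,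
    P {ω | pointCount p A ω = k} =
      ENNReal.ofReal (Real.exp (-(Λ A).toReal) * (Λ A).toReal ^ k / (k ! : ℝ))
  indep : ∀ (n : ℕ) (A : Fin n → Set F), (∀ j, MeasurableSet (A j)) →
    (Pairwise fun i j => Disjoint (A i) (A j)) →
    iIndepFun (fun j => pointCount p (A j)) P

/-- The intensity `dξ / ξ²` on `(0, ∞)`. -/
def frechetIntensity : Measure ℝ :=
  (volume.restrict (Ioi 0)).withDensity fun x => ENNReal.ofReal (1 / x ^ 2)

/-! ### Random compact sets -/

/-- The usual σ-algebra on compact sets (for random closed sets), generated by the events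
`{B | B ∩ K ≠ ∅}` with `K` compact. -/
instance compactsMeasurableSpace {E : Type*} [TopologicalSpace E] :
    MeasurableSpace (TopologicalSpace.Compacts E) :=
  MeasurableSpace.generateFrom
    {H | ∃ K : Set E, IsCompact K ∧
      H = {B : TopologicalSpace.Compacts E | ((B : Set E) ∩ K).Nonempty}}

/-- The mean volume `𝔼|B|`. -/
def meanVolume {d : ℕ} {Ω : Type*} [MeasurableSpace Ω] (P : Measure Ω)
    (B : Ω → TopologicalSpace.Compacts (EuclideanSpace ℝ (Fin d))) : ℝ≥0∞ :=
  ∫⁻ ω, volume (B ω : Set (EuclideanSpace ℝ (Fin d))) ∂P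

/-- `α(h) = 𝔼|B ∩ (h + B)| / 𝔼|B|`. -/
def overlapRatio {d : ℕ} {Ω : Type*} [MeasurableSpace Ω] (P : Measure Ω)
    (B : Ω → TopologicalSpace.Compacts (EuclideanSpace ℝ (Fin d)))
    (h : EuclideanSpace ℝ (Fin d)) : ℝ :=
  (∫⁻ ω, volume ((B ω : Set (EuclideanSpace ℝ (Fin d))) ∩
      ((fun x => h + x) '' (B ω : Set (EuclideanSpace ℝ (Fin d))))) ∂P).toReal /
    (meanVolume P B).toReal

/-! ### The truncated extremal Gaussian process -/

/-- `X` is the truncated extremal Gaussian process on `ℝᵈ` with correlation function `ρ` (of the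
underlying stationary Gaussian process) and truncation sets `B i`, through its spectral
representation `X(s) = μ⁻¹ maxᵢ ξᵢ Wᵢ⁺(s) 𝟙_{Bᵢ}(s - cᵢ)`, `μ⁻¹ = √(2π) / 𝔼|B|`. -/
structure IsTruncatedExtremalGaussian {d : ℕ} {Ω : Type*} [MeasurableSpace Ω] (P : Measure Ω)
    (X : EuclideanSpace ℝ (Fin d) → Ω → ℝ) (ρ : EuclideanSpace ℝ (Fin d) → ℝ)
    (ξ : ℕ → Ω → ℝ) (c : ℕ → Ω → EuclideanSpace ℝ (Fin d))
    (W : ℕ → EuclideanSpace ℝ (Fin d) → Ω → ℝ)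
    (B : ℕ → Ω → TopologicalSpace.Compacts (EuclideanSpace ℝ (Fin d))) : Prop where
  /-- The points `(ξᵢ, cᵢ)` form a Poisson process on `(0, ∞) × ℝᵈ` with intensity
  `ξ⁻² dξ dc`. -/
  poisson : IsPoissonPointProcess P (fun i ω => (ξ i ω, c i ω)) (frechetIntensity.prod volume)
  /-- The `Wᵢ` are standard stationary Gaussian processes with correlation function `ρ`. -/
  measurable_W : ∀ i s, Measurable (W i s)
  gaussian_W : ∀ i, IsGaussianProcess (W i) P
  mean_W : ∀ i s, ∫ ω, W i s ω ∂P = 0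
  cov_W : ∀ i s t, covariance (W i s) (W i t) P = ρ (t - s)
  var_W : ρ 0 = 1
  /-- The `Bᵢ` are identically distributed random compact sets with `0 < 𝔼|B| < ∞`. -/
  measurable_B : ∀ i, Measurable (B i)
  identDistrib_B : ∀ i, IdentDistrib (B i) (B 0) P P
  meanVolume_pos : meanVolume P (B 0) ≠ 0
  meanVolume_finite : meanVolume P (B 0) ≠ ∞
  /-- The `Wᵢ` are independent, the `Bᵢ` are independent, and the points `(ξᵢ, cᵢ)`, the
  sequence `W` and the sequence `B` are independent of one another. -/
  indep_W : iIndepFun (fun i ω s => W i s ω) P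
  indep_B : iIndepFun B P
  indep_W_B : IndepFun (fun ω i s => W i s ω) (fun ω i => B i ω) P
  indep_points : IndepFun (fun ω i => (ξ i ω, c i ω))
    (fun ω => ((fun i s => W i s ω), (fun i => B i ω))) P
  /-- The spectral representation. -/
  spectral : ∀ s, ∀ᵐ ω ∂P, IsLUB
    (range fun i => √(2 * Real.pi) / (meanVolume P (B 0)).toReal *
      (ξ i ω * max (W i s ω) 0 *
        indicator (B i ω : Set (EuclideanSpace ℝ (Fin d))) (fun _ => (1 : ℝ)) (s - c i ω)))
    (X s ω)

end

/-!
The exponent function of the model is `V(x, y) = (1 - a/2)(1/x + 1/y) + (a/2) Q(x, y) / (x y)` with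
`Q(x, y) = √(x² - 2 R x y + y²)`.

*Covariance formula.* For `R < 1` the root `Q` does not vanish on the open quadrant, so a pair with
distribution function `exp (-V)` has the density `(V₁ V₂ - V₁₂) exp (-V)` there; nothing is lost at
the axes because `V` blows up at them (`HasTEGPairLaw.map_eq_withDensity`). As `V` is homogeneous
of order `-1`, the substitution `y = w x` turns `x V`, `x⁴ V₁ V₂` and `-x³ V₁₂` into functions of
`w` alone, and these are `T₁`, `T₂`, `T₃` (`tegDensity_scale`). The integral over `x` along the ray
of slope `w` is then a sum of two inverse Gamma integrals, whose value is the integrand of the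
covariance formula (`lintegral_ray`), so `𝔼 |Y|^ν |Z|^ν` is its integral over `w`. Everything is
nonnegative, hence absolute convergence comes with the finiteness of the mixed moment; the margins
are unit Fréchet and have the moments `Γ(1 - κ)`. If `R = 1`, then `a = 0` and `R` plays no role
(`HasTEGPairLaw.hasTEGCovariance`).

*Spectral representation.* `X s ≤ x₁` and `X (s + h) ≤ x₂` mean that no point `(ξᵢ, cᵢ)` with mark
`(Wᵢ, Bᵢ)` lies in an exceedance set. Conditionally on the points these are independent events, so
the Laplace functional of the Poisson process (`IsPoissonPointProcess.lintegral_expNeg_tsum`)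
shows that the probability is `exp (-I)`, where `I` is the mean number of exceedances
(`IsPoissonPointProcess.measure_forall_notMem_marked`). Integrating over `ξ` leaves the mean of
`max (α W(s), β W(s + h), 0)`, where the weights `α` and `β` vanish unless `B`, centred at `c`,
covers `s` and `s + h`, respectively. For a symmetric law this mean is half of the mean range of
`α W(s)`, `β W(s + h)`, `0`, which involves only absolute moments of centred Gaussian variables
(`IsStdGaussianPair.lintegral_max`). The remaining integral over the centre `c` only needs the
volumes of `B` and of `B ∩ (h + B)`, and `I = V(x₁, x₂)`
(`lintegral_exceedanceSet_eq_tegExponent`).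
-/

noncomputable section

/-! ### The exponent function and its derivatives -/

/-- The quadratic root `√(x² - 2 R x y + y²)`, in terms of which the exponent function of the
truncated extremal Gaussian model has no nested fractions. -/
def tegRoot (R x y : ℝ) : ℝ := √(x ^ 2 - 2 * R * x * y + y ^ 2)

/-- The slope `-x² ∂V/∂x` of the exponent function `V`; by symmetry `-y² ∂V/∂y` is
`tegSlope a R y x`. -/
def tegSlope (a R x y : ℝ) : ℝ := 1 - a / 2 + a / 2 * ((y - R * x) / tegRoot R x y)

/-- The joint density `(V₁ V₂ - V₁₂) exp (-V)` of the bivariate law with distribution function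
`exp (-V)`. -/
def tegDensity (a R x y : ℝ) : ℝ :=
  (tegSlope a R x y / x ^ 2 * (tegSlope a R y x / y ^ 2)
    + a / 2 * ((1 - R ^ 2) / tegRoot R x y ^ 3)) * Real.exp (-tegExponent a R x y)

lemma tegRoot_comm (R x y : ℝ) : tegRoot R x y = tegRoot R y x := by
  unfold tegRoot; congr 1; ring

lemma quadForm_pos {R x y : ℝ} (hR2 : R < 1) (hx : 0 < x) (hy : 0 < y) :
    0 < x ^ 2 - 2 * R * x * y + y ^ 2 := by
  have h : x ^ 2 - 2 * R * x * y + y ^ 2 = (x - y) ^ 2 + 2 * (1 - R) * (x * y) := by ring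
  have := mul_pos (sub_pos.2 hR2) (mul_pos hx hy)
  rw [h]; nlinarith [sq_nonneg (x - y)]

lemma tegRoot_pos {R x y : ℝ} (hR2 : R < 1) (hx : 0 < x) (hy : 0 < y) :
    0 < tegRoot R x y := Real.sqrt_pos.2 (quadForm_pos hR2 hx hy)

lemma tegRoot_sq {R x y : ℝ} (hR2 : R < 1) (hx : 0 < x) (hy : 0 < y) :
    tegRoot R x y ^ 2 = x ^ 2 - 2 * R * x * y + y ^ 2 :=
  Real.sq_sqrt (quadForm_pos hR2 hx hy).le

lemma tegRoot_scale {R x w : ℝ} (hx : 0 < x) : tegRoot R x (x * w) = x * tegRoot R 1 w := by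
  unfold tegRoot
  rw [show x ^ 2 - 2 * R * x * (x * w) + (x * w) ^ 2
    = x ^ 2 * (1 ^ 2 - 2 * R * 1 * w + w ^ 2) by ring, Real.sqrt_mul (sq_nonneg x),
    Real.sqrt_sq hx.le]

lemma tegRoot_le_add {R x y : ℝ} (hR1 : -1 ≤ R) (hx : 0 ≤ x) (hy : 0 ≤ y) :
    tegRoot R x y ≤ x + y := by
  rw [tegRoot, Real.sqrt_le_left (by positivity)]
  nlinarith [mul_nonneg hx hy]

lemma sqrt_one_sub_eq_tegRoot_div {R x y : ℝ} (hx : 0 < x) (hy : 0 < y) :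
    √(1 - 2 * (R + 1) * (x * y / (x + y) ^ 2)) = tegRoot R x y / (x + y) := by
  have hxy : 0 < x + y := by positivity
  unfold tegRoot
  rw [← Real.sqrt_sq hxy.le, ← Real.sqrt_div' _ (sq_nonneg _), Real.sqrt_sq hxy.le]
  congr 1
  field_simp
  ring

lemma tegExponent_eq {a R x y : ℝ} (hx : 0 < x) (hy : 0 < y) :
    tegExponent a R x y
      = (1 - a / 2) * (1 / x + 1 / y) + a / 2 * (tegRoot R x y / (x * y)) := by
  unfold tegExponent
  rw [sqrt_one_sub_eq_tegRoot_div hx hy]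
  field_simp
  ring

lemma tegExponent_comm (a R x y : ℝ) : tegExponent a R x y = tegExponent a R y x := by
  unfold tegExponent
  rw [add_comm (1 / x), mul_comm x y, add_comm x y]

/-- The exponent function dominates half of its value for independent coordinates. -/
lemma half_le_tegExponent {a R x y : ℝ} (ha0 : 0 ≤ a) (ha1 : a ≤ 1) (hx : 0 < x) (hy : 0 < y) :
    1 / 2 * (1 / x + 1 / y) ≤ tegExponent a R x y := by
  unfold tegExponent
  have h := Real.sqrt_nonneg (1 - 2 * (R + 1) * (x * y / (x + y) ^ 2))
  rw [mul_comm (1 / 2 : ℝ)]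
  have : 0 ≤ 1 / x + 1 / y := by positivity
  gcongr
  nlinarith [mul_nonneg ha0 h]

lemma tegExponent_le {a R x y : ℝ} (ha0 : 0 ≤ a) (hR1 : -1 ≤ R) (hx : 0 < x) (hy : 0 < y) :
    tegExponent a R x y ≤ 1 / x + 1 / y := by
  unfold tegExponent
  have h : √(1 - 2 * (R + 1) * (x * y / (x + y) ^ 2)) ≤ 1 := by
    refine Real.sqrt_le_iff.2 ⟨zero_le_one, ?_⟩
    have : 0 ≤ 2 * (R + 1) * (x * y / (x + y) ^ 2) := by
      have : 0 ≤ R + 1 := by linarith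
      positivity
    rw [one_pow]; linarith
  have h2 : 0 ≤ 1 / x + 1 / y := by positivity
  refine mul_le_of_le_one_right h2 ?_
  nlinarith

lemma le_tegExponent {a R x y : ℝ} (ha0 : 0 ≤ a) (ha1 : a ≤ 1) (hR2 : R ≤ 1)
    (hx : 0 < x) (hy : 0 < y) : 1 / x ≤ tegExponent a R x y := by
  rw [tegExponent_eq hx hy]
  have h : y - x ≤ tegRoot R x y := by
    refine Real.le_sqrt_of_sq_le ?_
    nlinarith [mul_nonneg (sub_nonneg.2 hR2) (mul_pos hx hy).le]
  have h2 : (y - x) / (x * y) ≤ tegRoot R x y / (x * y) := by gcongr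
  have h3 : (y - x) / (x * y) = 1 / x - 1 / y := by field_simp
  rw [h3] at h2
  have h4 : 0 ≤ (1 - a) * (1 / y) := mul_nonneg (by linarith) (by positivity)
  nlinarith

lemma abs_slope_quotient_le {R x y : ℝ} (hR1 : -1 ≤ R) (hR2 : R < 1) (hx : 0 < x) (hy : 0 < y) :
    |(y - R * x) / tegRoot R x y| ≤ 1 := by
  have h := tegRoot_pos hR2 hx hy
  rw [abs_div, abs_of_pos h, div_le_one h]
  refine Real.abs_le_sqrt ?_
  nlinarith [mul_nonneg (mul_nonneg (sub_nonneg.2 hR2.le) (by linarith : 0 ≤ 1 + R))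
    (sq_nonneg x)]

lemma tegSlope_nonneg {a R x y : ℝ} (ha0 : 0 ≤ a) (ha1 : a ≤ 1) (hR1 : -1 ≤ R) (hR2 : R < 1)
    (hx : 0 < x) (hy : 0 < y) : 0 ≤ tegSlope a R x y := by
  have := (abs_le.1 (abs_slope_quotient_le hR1 hR2 hx hy)).1
  unfold tegSlope; nlinarith

lemma tegSlope_le_one {a R x y : ℝ} (ha0 : 0 ≤ a) (hR1 : -1 ≤ R) (hR2 : R < 1)
    (hx : 0 < x) (hy : 0 < y) : tegSlope a R x y ≤ 1 := by
  have := (abs_le.1 (abs_slope_quotient_le hR1 hR2 hx hy)).2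
  unfold tegSlope; nlinarith

lemma tegDensity_nonneg {a R x y : ℝ} (ha0 : 0 ≤ a) (ha1 : a ≤ 1) (hR1 : -1 ≤ R) (hR2 : R < 1)
    (hx : 0 < x) (hy : 0 < y) : 0 ≤ tegDensity a R x y := by
  have h1 := tegSlope_nonneg ha0 ha1 hR1 hR2 hx hy
  have h2 := tegSlope_nonneg ha0 ha1 hR1 hR2 hy hx
  have h3 := tegRoot_pos hR2 hx hy
  have h4 : 0 ≤ 1 - R ^ 2 := by nlinarith
  unfold tegDensity; positivity

lemma hasDerivAt_tegRoot {R x y : ℝ} (hR2 : R < 1) (hx : 0 < x) (hy : 0 < y) :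
    HasDerivAt (fun y => tegRoot R x y) ((y - R * x) / tegRoot R x y) y := by
  have h : HasDerivAt (fun y : ℝ => x ^ 2 - 2 * R * x * y + y ^ 2) (2 * (y - R * x)) y := by
    have := (((hasDerivAt_id y).const_mul (2 * R * x)).const_sub (x ^ 2)).add
      ((hasDerivAt_id y).pow 2)
    refine this.congr_deriv ?_
    simp; ring
  refine (h.sqrt (quadForm_pos hR2 hx hy).ne').congr_deriv ?_
  have := (tegRoot_pos hR2 hx hy).ne'
  unfold tegRoot at *
  field_simp

lemma hasDerivAt_tegExponent {a R x y : ℝ} (hR2 : R < 1)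
    (hx : 0 < x) (hy : 0 < y) :
    HasDerivAt (fun y => tegExponent a R x y) (-(tegSlope a R y x / y ^ 2)) y := by
  have hQ := (tegRoot_pos hR2 hx hy).ne'
  have hQ2 := tegRoot_sq hR2 hx hy
  have h1 := (((hasDerivAt_inv hy.ne').const_add (1 / x)).const_mul (1 - a / 2)).add
    (((hasDerivAt_tegRoot hR2 hx hy).div ((hasDerivAt_id y).const_mul x)
      (by simp; exact ⟨hx.ne', hy.ne'⟩)).const_mul (a / 2))
  have h2 : (fun y => tegExponent a R x y) =ᶠ[nhds y]
      (fun y => (1 - a / 2) * (1 / x + y⁻¹)) +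
        (fun y => a / 2 * (tegRoot R x y / (x * id y))) := by
    filter_upwards [lt_mem_nhds hy] with z hz
    simp [tegExponent_eq hx hz]
  refine (h1.congr_of_eventuallyEq h2).congr_deriv ?_
  have key : (y - R * x) / tegRoot R x y * (x * y) - tegRoot R x y * x
      = -(x ^ 2 * ((x - R * y) / tegRoot R x y)) := by
    field_simp
    rw [hQ2]; ring
  unfold tegSlope
  rw [tegRoot_comm R y x]
  simp only [id, mul_one]
  rw [key]
  field_simp
  ring

lemma hasDerivAt_tegSlope {a R x y : ℝ} (hR2 : R < 1)
    (hx : 0 < x) (hy : 0 < y) :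
    HasDerivAt (fun y => tegSlope a R x y)
      (a / 2 * (x ^ 2 * (1 - R ^ 2) / tegRoot R x y ^ 3)) y := by
  have hQ := (tegRoot_pos hR2 hx hy).ne'
  have hQ2 := tegRoot_sq hR2 hx hy
  have h1 := ((((hasDerivAt_id y).sub_const (R * x)).div
    (hasDerivAt_tegRoot hR2 hx hy) hQ).const_mul (a / 2)).const_add (1 - a / 2)
  refine h1.congr_deriv ?_
  congr 1
  simp only [id]
  have : tegRoot R x y ^ 4 = tegRoot R x y ^ 2 * tegRoot R x y ^ 2 := by ring
  field_simp
  rw [hQ2]; ring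

/-- Differentiating `exp (-V)` in the first variable and then in the second gives the density. -/
lemma hasDerivAt_slope_mul_exp {a R x y : ℝ} (hR2 : R < 1)
    (hx : 0 < x) (hy : 0 < y) :
    HasDerivAt (fun y => tegSlope a R x y / x ^ 2 * Real.exp (-tegExponent a R x y))
      (tegDensity a R x y) y := by
  have hQ := (tegRoot_pos hR2 hx hy).ne'
  refine (((hasDerivAt_tegSlope hR2 hx hy).div_const (x ^ 2)).mul
    ((hasDerivAt_tegExponent hR2 hx hy).neg.exp)).congr_deriv ?_
  simp only [Pi.neg_apply]
  unfold tegDensity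
  field_simp
  ring

lemma hasDerivAt_exp_neg_tegExponent {a R x y : ℝ} (hR2 : R < 1)
    (hx : 0 < x) (hy : 0 < y) :
    HasDerivAt (fun x => Real.exp (-tegExponent a R x y))
      (tegSlope a R x y / x ^ 2 * Real.exp (-tegExponent a R x y)) x := by
  have h := (hasDerivAt_tegExponent (a := a) hR2 hy hx).neg.exp
  simp only [tegExponent_comm a R y] at h
  refine h.congr_deriv ?_
  simp only [Pi.neg_apply]
  ring

/-! ### The functions of the covariance formula -/

lemma tegK_eq {R w : ℝ} (hw : 0 < w) : tegK R w = tegRoot R 1 w / (w + 1) := by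
  rw [add_comm w 1, ← sqrt_one_sub_eq_tegRoot_div one_pos hw, tegK]
  congr 1
  rw [add_comm w 1]
  ring

lemma tegT1_eq {a R w : ℝ} (hw : 0 < w) : tegT1 a R w = tegExponent a R 1 w := by
  rw [tegT1, tegExponent_eq one_pos hw, tegK_eq hw]
  field_simp
  ring

lemma tegT2_eq {a R w : ℝ} (hR2 : R < 1) (hw : 0 < w) :
    tegT2 a R w = tegSlope a R 1 w * (tegSlope a R w 1 / w ^ 2) := by
  have hQ := (tegRoot_pos hR2 one_pos hw).ne'
  have hQ2 := tegRoot_sq hR2 one_pos hw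
  have h1 : tegRoot R 1 w / (w + 1) - (R + 1) * (1 - w) / (tegRoot R 1 w / (w + 1) * (w + 1) ^ 2)
      = (w - R * 1) / tegRoot R 1 w := by
    field_simp
    rw [hQ2]; ring
  have h2 : tegRoot R 1 w / (w + 1)
      - w * ((R + 1) * (w - 1)) / (tegRoot R 1 w / (w + 1) * (w + 1) ^ 2)
      = (1 - R * w) / tegRoot R 1 w := by
    field_simp
    rw [hQ2]; ring
  rw [tegT2, tegK_eq hw, tegSlope, tegSlope, tegRoot_comm R w 1, ← h1, ← h2]
  congr 1
  · field_simp
    ring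
  · field_simp
    ring

lemma tegT3_eq {a R w : ℝ} (hR2 : R < 1) (hw : 0 < w) :
    tegT3 a R w = a / 2 * ((1 - R ^ 2) / tegRoot R 1 w ^ 3) := by
  have hQ := (tegRoot_pos hR2 one_pos hw).ne'
  have hQ2 := tegRoot_sq hR2 one_pos hw
  rw [tegT3, tegK_eq hw]
  have : (R + 1) / (tegRoot R 1 w / (w + 1) * (w + 1) ^ 3)
    - (R + 1) ^ 2 * (w - 1) ^ 2 / (2 * (tegRoot R 1 w / (w + 1)) ^ 3 * (w + 1) ^ 5)
    = 1 / 2 * ((1 - R ^ 2) / tegRoot R 1 w ^ 3) := by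
    field_simp
    rw [hQ2]; ring
  rw [this]; ring

lemma tegExponent_scale {a R x w : ℝ} (hx : 0 < x) (hw : 0 < w) :
    tegExponent a R x (x * w) = tegT1 a R w / x := by
  rw [tegT1_eq hw, tegExponent_eq hx (mul_pos hx hw), tegExponent_eq one_pos hw,
    tegRoot_scale hx]
  field_simp

/-- On the ray of slope `w` the density is explicit in `T₁`, `T₂`, `T₃`. -/
lemma tegDensity_scale {a R x w : ℝ} (hR2 : R < 1) (hx : 0 < x) (hw : 0 < w) :
    tegDensity a R x (x * w)
      = (tegT2 a R w / x ^ 4 + tegT3 a R w / x ^ 3) * Real.exp (-(tegT1 a R w / x)) := by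
  have hQ := (tegRoot_pos hR2 one_pos hw).ne'
  rw [tegDensity, tegExponent_scale hx hw, tegT2_eq hR2 hw, tegT3_eq hR2 hw]
  congr 1
  unfold tegSlope
  rw [tegRoot_comm R (x * w) x, tegRoot_scale hx, tegRoot_comm R w 1,
    show (x * w - R * x) / (x * tegRoot R 1 w) = (w - R * 1) / tegRoot R 1 w by field_simp,
    show (x - R * (x * w)) / (x * tegRoot R 1 w) = (1 - R * w) / tegRoot R 1 w by field_simp]
  field_simp

lemma tegT1_pos {a R w : ℝ} (ha0 : 0 ≤ a) (ha1 : a ≤ 1) (hw : 0 < w) : 0 < tegT1 a R w := by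
  rw [tegT1_eq hw]
  exact lt_of_lt_of_le (by positivity) (half_le_tegExponent ha0 ha1 one_pos hw)

lemma tegT2_nonneg {a R w : ℝ} (ha0 : 0 ≤ a) (ha1 : a ≤ 1) (hR1 : -1 ≤ R) (hR2 : R < 1)
    (hw : 0 < w) : 0 ≤ tegT2 a R w := by
  rw [tegT2_eq hR2 hw]
  have h1 := tegSlope_nonneg ha0 ha1 hR1 hR2 one_pos hw
  have h2 := tegSlope_nonneg ha0 ha1 hR1 hR2 hw one_pos
  positivity

lemma tegT3_nonneg {a R w : ℝ} (ha0 : 0 ≤ a) (hR1 : -1 ≤ R) (hR2 : R < 1)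
    (hw : 0 < w) : 0 ≤ tegT3 a R w := by
  rw [tegT3_eq hR2 hw]
  have h3 := tegRoot_pos hR2 one_pos hw
  have h4 : 0 ≤ 1 - R ^ 2 := by nlinarith
  positivity

/-! ### Laws determined by their distribution functions -/

/-- The fundamental theorem of calculus on `(0, b]` for a nonnegative derivative and a primitive
that is only controlled through its limit `0` at `0⁺`; no integrability is assumed. -/
lemma lintegral_Ioc_of_hasDerivAt {F F' : ℝ → ℝ} {b : ℝ} (hb : 0 < b)
    (hd : ∀ x, 0 < x → HasDerivAt F (F' x) x) (hpos : ∀ x, 0 < x → 0 ≤ F' x)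
    (hl : Filter.Tendsto F (nhdsWithin 0 (Ioi 0)) (nhds 0)) :
    ∫⁻ x in Ioc 0 b, ENNReal.ofReal (F' x) = ENNReal.ofReal (F b) := by
  set g : ℝ → ℝ := (Ioi (0 : ℝ)).indicator F with hg
  have hgd : ∀ x, 0 < x → HasDerivAt g (F' x) x := fun x hx => by
    refine (hd x hx).congr_of_eventuallyEq ?_
    filter_upwards [lt_mem_nhds hx] with z hz
    simp [hg, indicator_of_mem (show z ∈ Ioi (0 : ℝ) from hz)]
  have hc : ContinuousOn g (Icc 0 b) := by
    intro x hx
    rcases hx.1.eq_or_lt with h | h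
    · subst h
      have h0 : g 0 = 0 := by simp [hg]
      rw [← continuousWithinAt_sdiff_self]
      have hs : Icc 0 b \ {0} ⊆ Ioi (0 : ℝ) := fun z hz =>
        lt_of_le_of_ne hz.1.1 (fun h => hz.2 h.symm)
      rw [ContinuousWithinAt, h0]
      refine Filter.Tendsto.congr' ?_ (hl.mono_left (nhdsWithin_mono _ hs))
      filter_upwards [self_mem_nhdsWithin] with z hz
      rw [hg, indicator_of_mem (hs hz)]
    · exact (hgd x h).continuousAt.continuousWithinAt
  have hi : IntegrableOn F' (Ioc 0 b) :=
    intervalIntegral.integrableOn_deriv_of_nonneg hc (fun x hx => hgd x hx.1)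
      (fun x hx => hpos x hx.1)
  have hv := intervalIntegral.integral_eq_sub_of_hasDerivAt_of_le hb.le hc
    (fun x hx => hgd x hx.1) ((intervalIntegrable_iff_integrableOn_Ioc_of_le hb.le).2 hi)
  rw [intervalIntegral.integral_of_le hb.le] at hv
  rw [← ofReal_integral_eq_lintegral_ofReal hi
    ((ae_restrict_iff' measurableSet_Ioc).2 (ae_of_all _ fun x hx => hpos x hx.1)), hv]
  simp [hg, indicator_of_mem (show b ∈ Ioi (0 : ℝ) from hb)]

/-- Two measures on the plane agree if they agree on all quadrants `(-∞, x] × (-∞, y]`. -/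
lemma ext_of_Iic_prod_Iic {μ ν : Measure (ℝ × ℝ)} [IsFiniteMeasure μ]
    (h : ∀ x y : ℝ, μ (Iic x ×ˢ Iic y) = ν (Iic x ×ˢ Iic y)) : μ = ν := by
  have hspan : IsCountablySpanning (range (Iic : ℝ → Set ℝ)) :=
    ⟨fun n : ℕ => Iic (n : ℝ), fun n => mem_range_self _, by
      refine iUnion_eq_univ_iff.2 fun x => ?_
      obtain ⟨n, hn⟩ := exists_nat_ge x
      exact ⟨n, hn⟩⟩
  have hgen : (Prod.instMeasurableSpace : MeasurableSpace (ℝ × ℝ))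
      = MeasurableSpace.generateFrom
        (image2 (fun s t => s ×ˢ t) (range (Iic : ℝ → Set ℝ)) (range Iic)) := by
    rw [← generateFrom_prod_eq hspan hspan, ← borel_eq_generateFrom_Iic,
      ← BorelSpace.measurable_eq (α := ℝ)]
  refine Measure.ext_of_generateFrom_of_iUnion _ (fun n : ℕ => Iic (n : ℝ) ×ˢ Iic (n : ℝ))
    hgen (isPiSystem_Iic.prod isPiSystem_Iic) ?_
    (fun n => mem_image2_of_mem (mem_range_self _) (mem_range_self _))
    (fun n => measure_ne_top _ _) ?_
  · refine iUnion_eq_univ_iff.2 fun p => ?_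
    obtain ⟨n, hn⟩ := exists_nat_ge (max p.1 p.2)
    exact ⟨n, ⟨(le_max_left _ _).trans hn, (le_max_right _ _).trans hn⟩⟩
  · rintro _ ⟨_, ⟨x, rfl⟩, _, ⟨y, rfl⟩, rfl⟩
    exact h x y

lemma tendsto_exp_neg_inv_nhdsGT_zero {c : ℝ} (hc : 0 < c) :
    Filter.Tendsto (fun x : ℝ => Real.exp (-(c * (1 / x)))) (nhdsWithin 0 (Ioi 0)) (nhds 0) := by
  refine Real.tendsto_exp_neg_atTop_nhds_zero.comp ?_
  simp only [one_div]
  exact tendsto_inv_nhdsGT_zero.const_mul_atTop hc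

section Frechet

variable {Ω : Type*} [MeasurableSpace Ω] {P : Measure Ω} [IsProbabilityMeasure P]

/-- A random variable with the unit Fréchet distribution function has the unit Fréchet density. -/
lemma map_eq_withDensity_of_frechet {Y : Ω → ℝ} (hY : AEMeasurable Y P)
    (h : ∀ x, 0 < x → P {ω | Y ω ≤ x} = ENNReal.ofReal (Real.exp (-(1 / x)))) :
    P.map Y = (volume.restrict (Ioi 0)).withDensity
      fun x => ENNReal.ofReal (1 / x ^ 2 * Real.exp (-(1 / x))) := by
  have := Measure.isProbabilityMeasure_map hY
  have h0 : P {ω | Y ω ≤ 0} = 0 := by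
    refine le_antisymm ?_ zero_le
    have ht := ENNReal.tendsto_ofReal (tendsto_exp_neg_inv_nhdsGT_zero one_pos)
    rw [ENNReal.ofReal_zero] at ht
    refine ge_of_tendsto ht ?_
    filter_upwards [self_mem_nhdsWithin] with x hx
    rw [one_mul, ← h x hx]
    exact measure_mono fun ω hω => (show Y ω ≤ 0 from hω).trans (le_of_lt (mem_Ioi.1 hx))
  refine Measure.ext_of_Iic _ _ fun x => ?_
  rw [Measure.map_apply_of_aemeasurable hY measurableSet_Iic,
    withDensity_apply _ measurableSet_Iic, Measure.restrict_restrict measurableSet_Iic,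
    inter_comm, Ioi_inter_Iic]
  rcases le_or_gt x 0 with hx | hx
  · rw [Ioc_eq_empty (not_lt.2 hx), Measure.restrict_empty, lintegral_zero_measure]
    exact measure_mono_null (fun ω hω => le_trans hω hx) h0
  · rw [lintegral_Ioc_of_hasDerivAt hx (F := fun x => Real.exp (-(1 / x)))]
    · exact h x hx
    · intro z hz
      have := ((hasDerivAt_inv hz.ne').neg).exp
      simp only [Pi.neg_apply, neg_neg] at this
      simp only [one_div]
      refine this.congr_deriv ?_
      ring
    · intro z hz; positivity
    · simpa using tendsto_exp_neg_inv_nhdsGT_zero one_pos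

/-- The inverse Gamma integral `∫₀^∞ x^{-s-1} e^{-T/x} dx = Γ(s) T^{-s}`. -/
lemma lintegral_inverse_gamma {s T : ℝ} (hs : 0 < s) (hT : 0 < T) :
    ∫⁻ x in Ioi (0 : ℝ), ENNReal.ofReal (x ^ (-s - 1) * Real.exp (-(T / x)))
      = ENNReal.ofReal (Real.Gamma s * T ^ (-s)) := by
  set g : ℝ → ℝ := fun t => t ^ (s - 1) * Real.exp (-(T * t)) with hg
  have heq : EqOn (fun x : ℝ => x ^ (-s - 1) * Real.exp (-(T / x)))
      (fun x => (|(-1 : ℝ)| * x ^ ((-1 : ℝ) - 1)) • g (x ^ (-1 : ℝ))) (Ioi 0) := by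
    intro x hx
    have hx : 0 < x := hx
    simp only [hg, abs_neg, abs_one, one_mul, smul_eq_mul, ← mul_assoc]
    rw [← Real.rpow_mul hx.le, ← Real.rpow_add hx, Real.rpow_neg_one, div_eq_mul_inv]
    congr 2; ring
  have hgi : IntegrableOn g (Ioi 0) := by
    have := integrableOn_rpow_mul_exp_neg_mul_rpow (s := s - 1) (p := 1) (b := T) (by linarith)
      one_pos hT
    simpa [hg] using this
  have hi : IntegrableOn (fun x : ℝ => x ^ (-s - 1) * Real.exp (-(T / x))) (Ioi 0) :=
    ((integrableOn_Ioi_comp_rpow_iff g (by norm_num : (-1 : ℝ) ≠ 0)).2 hgi).congr_fun heq.symm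
      measurableSet_Ioi
  rw [← ofReal_integral_eq_lintegral_ofReal hi ((ae_restrict_iff' measurableSet_Ioi).2
    (ae_of_all _ fun x hx => by have hx : 0 < x := hx; positivity)),
    setIntegral_congr_fun measurableSet_Ioi heq, integral_comp_rpow_Ioi g (by norm_num),
    Real.integral_rpow_mul_exp_neg_mul_Ioi hs hT, one_div, Real.inv_rpow hT.le,
    Real.rpow_neg hT.le, mul_comm]

lemma lintegral_abs_rpow_of_frechet {Y : Ω → ℝ} (hY : AEMeasurable Y P)
    (h : ∀ x, 0 < x → P {ω | Y ω ≤ x} = ENNReal.ofReal (Real.exp (-(1 / x))))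
    {κ : ℝ} (hκ : κ < 1) :
    ∫⁻ ω, ENNReal.ofReal (|Y ω| ^ κ) ∂P = ENNReal.ofReal (Real.Gamma (1 - κ)) := by
  have hm : Measurable fun x : ℝ => ENNReal.ofReal (|x| ^ κ) := by fun_prop
  rw [← lintegral_map' (f := fun x : ℝ => ENNReal.ofReal (|x| ^ κ)) hm.aemeasurable hY,
    map_eq_withDensity_of_frechet hY h,
    lintegral_withDensity_eq_lintegral_mul _ (by fun_prop) hm]
  have := lintegral_inverse_gamma (s := 1 - κ) (T := 1) (by linarith) one_pos
  rw [Real.one_rpow, mul_one] at this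
  rw [← this]
  refine setLIntegral_congr_fun measurableSet_Ioi fun x hx => ?_
  have hx : 0 < x := hx
  simp only [Pi.mul_apply]
  rw [← ENNReal.ofReal_mul (by positivity), abs_of_pos hx]
  congr 1
  rw [show -(1 - κ) - 1 = κ - (2 : ℕ) by push_cast; ring, Real.rpow_sub_natCast hx.ne']
  ring

end Frechet

lemma measurable_tegDensity (a R : ℝ) :
    Measurable fun p : ℝ × ℝ => tegDensity a R p.1 p.2 := by
  unfold tegDensity tegSlope tegRoot tegExponent
  fun_prop

lemma HasTEGPairLaw.symm {Ω : Type*} [MeasurableSpace Ω] {P : Measure Ω} {Y Z : Ω → ℝ} {a R : ℝ}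
    (h : HasTEGPairLaw P Y Z a R) : HasTEGPairLaw P Z Y a R where
  aemeasurable_fst := h.aemeasurable_snd
  aemeasurable_snd := h.aemeasurable_fst
  cdf x₁ x₂ h₁ h₂ := by
    rw [tegExponent_comm, ← h.cdf x₂ x₁ h₂ h₁]
    simp only [and_comm]

section PairLaw

variable {Ω : Type*} [MeasurableSpace Ω] {P : Measure Ω} {Y Z : Ω → ℝ} {a R : ℝ}

/-- The margins of the truncated extremal Gaussian pair law are unit Fréchet. -/
lemma HasTEGPairLaw.cdf_fst (h : HasTEGPairLaw P Y Z a R) (ha0 : 0 ≤ a) (ha1 : a ≤ 1)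
    (hR1 : -1 ≤ R) (hR2 : R ≤ 1) {x : ℝ} (hx : 0 < x) :
    P {ω | Y ω ≤ x} = ENNReal.ofReal (Real.exp (-(1 / x))) := by
  have hU : {ω | Y ω ≤ x} = ⋃ n : ℕ, {ω | Y ω ≤ x ∧ Z ω ≤ (n : ℝ) + 1} := by
    ext ω
    simp only [mem_ofPred_eq, mem_iUnion]
    refine ⟨fun hω => ?_, fun ⟨n, hn⟩ => hn.1⟩
    obtain ⟨n, hn⟩ := exists_nat_ge (Z ω)
    exact ⟨n, hω, by linarith⟩
  have hmono : Monotone fun n : ℕ => {ω | Y ω ≤ x ∧ Z ω ≤ (n : ℝ) + 1} := fun m n hmn ω hω =>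
    ⟨hω.1, hω.2.trans (by gcongr)⟩
  have ht := tendsto_measure_iUnion_atTop (μ := P) hmono
  rw [← hU] at ht
  refine tendsto_nhds_unique ht ?_
  simp only [Function.comp_def]
  have hpos : ∀ n : ℕ, (0 : ℝ) < (n : ℝ) + 1 := fun n => by positivity
  simp only [h.cdf x _ hx (hpos _)]
  refine ENNReal.tendsto_ofReal ((Real.continuous_exp.tendsto _).comp ?_)
  refine Filter.Tendsto.neg ?_
  refine tendsto_of_tendsto_of_tendsto_of_le_of_le (g := fun _ : ℕ => 1 / x)
    (h := fun n : ℕ => 1 / x + 1 / ((n : ℝ) + 1)) tendsto_const_nhds ?_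
    (fun n => le_tegExponent ha0 ha1 hR2 hx (hpos n))
    (fun n => tegExponent_le ha0 hR1 hx (hpos n))
  simpa using tendsto_one_div_add_atTop_nhds_zero_nat.const_add (1 / x)

/-- The pair law has a density on the open quadrant. -/
lemma HasTEGPairLaw.map_eq_withDensity [IsProbabilityMeasure P] (h : HasTEGPairLaw P Y Z a R)
    (ha0 : 0 ≤ a) (ha1 : a ≤ 1) (hR1 : -1 ≤ R) (hR2 : R < 1) :
    P.map (fun ω => (Y ω, Z ω)) =
      ((volume.restrict (Ioi 0)).prod (volume.restrict (Ioi 0))).withDensity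
        fun p => ENNReal.ofReal (tegDensity a R p.1 p.2) := by
  have hm := h.aemeasurable_fst.prodMk h.aemeasurable_snd
  have := Measure.isProbabilityMeasure_map hm
  have hz : ∀ {Y Z : Ω → ℝ}, HasTEGPairLaw P Y Z a R → P {ω | Y ω ≤ 0} = 0 := fun h => by
    have := congrArg (fun μ => μ (Iic 0)) (map_eq_withDensity_of_frechet h.aemeasurable_fst
      fun x hx => h.cdf_fst ha0 ha1 hR1 hR2.le hx)
    beta_reduce at this
    rw [Measure.map_apply_of_aemeasurable h.aemeasurable_fst measurableSet_Iic,
      withDensity_apply _ measurableSet_Iic, Measure.restrict_restrict measurableSet_Iic,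
      inter_comm, Ioi_inter_Iic, Ioc_self, Measure.restrict_empty, lintegral_zero_measure] at this
    exact this
  have hdm : Measurable fun p : ℝ × ℝ => ENNReal.ofReal (tegDensity a R p.1 p.2) :=
    (measurable_tegDensity a R).ennreal_ofReal
  refine ext_of_Iic_prod_Iic fun x y => ?_
  rw [Measure.map_apply_of_aemeasurable hm (measurableSet_Iic.prod measurableSet_Iic),
    withDensity_apply _ (measurableSet_Iic.prod measurableSet_Iic), ← Measure.prod_restrict,
    lintegral_prod _ hdm.aemeasurable, Measure.restrict_restrict measurableSet_Iic,
    Measure.restrict_restrict measurableSet_Iic, inter_comm (Iic x), inter_comm (Iic y),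
    Ioi_inter_Iic, Ioi_inter_Iic]
  rcases le_or_gt x 0 with hx | hx
  · rw [Ioc_eq_empty (not_lt.2 hx), Measure.restrict_empty, lintegral_zero_measure]
    exact measure_mono_null (fun ω hω => le_trans hω.1 hx) (hz h)
  rcases le_or_gt y 0 with hy | hy
  · rw [Ioc_eq_empty (not_lt.2 hy), Measure.restrict_empty]
    simp only [lintegral_zero_measure, lintegral_zero]
    exact measure_mono_null (fun ω hω => le_trans hω.2 hy) (hz h.symm)
  have hlim : ∀ {x : ℝ}, 0 < x → ∀ y, 0 < y →
      Real.exp (-tegExponent a R x y) ≤ Real.exp (-(1 / 2 * (1 / y))) := fun hx y hy => by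
    refine Real.exp_le_exp.2 (neg_le_neg ((half_le_tegExponent ha0 ha1 hx hy).trans' ?_))
    have := one_div_pos.2 hx
    linarith
  -- the inner integral is the partial derivative of `exp (-V)` in the first variable
  have hin : ∀ t ∈ Ioc (0 : ℝ) x, ∫⁻ u in Ioc 0 y, ENNReal.ofReal (tegDensity a R t u)
      = ENNReal.ofReal (tegSlope a R t y / t ^ 2 * Real.exp (-tegExponent a R t y)) := by
    intro t ht
    refine lintegral_Ioc_of_hasDerivAt hy
      (F := fun u => tegSlope a R t u / t ^ 2 * Real.exp (-tegExponent a R t u))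
      (fun u hu => hasDerivAt_slope_mul_exp hR2 ht.1 hu)
      (fun u hu => tegDensity_nonneg ha0 ha1 hR1 hR2 ht.1 hu) ?_
    have h0 := (tendsto_exp_neg_inv_nhdsGT_zero (c := 1 / 2) (by norm_num)).const_mul (1 / t ^ 2)
    rw [mul_zero] at h0
    refine tendsto_of_tendsto_of_tendsto_of_le_of_le' tendsto_const_nhds h0 ?_ ?_
    · filter_upwards [self_mem_nhdsWithin] with u hu
      have := tegSlope_nonneg ha0 ha1 hR1 hR2 ht.1 hu
      positivity
    · filter_upwards [self_mem_nhdsWithin] with u hu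
      have h1 := tegSlope_le_one ha0 hR1 hR2 ht.1 hu
      exact mul_le_mul (by gcongr) (hlim ht.1 u hu) (Real.exp_nonneg _) (by positivity)
  rw [setLIntegral_congr_fun measurableSet_Ioc hin,
    lintegral_Ioc_of_hasDerivAt hx (F := fun t => Real.exp (-tegExponent a R t y))
      (fun t ht => hasDerivAt_exp_neg_tegExponent hR2 ht hy)
      (fun t ht => by
        have := tegSlope_nonneg ha0 ha1 hR1 hR2 ht hy
        positivity), ← h.cdf x y hx hy]
  · rfl
  · refine tendsto_of_tendsto_of_tendsto_of_le_of_le' tendsto_const_nhds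
      (tendsto_exp_neg_inv_nhdsGT_zero (c := 1 / 2) (by norm_num)) ?_ ?_
    · exact Filter.Eventually.of_forall fun t => Real.exp_nonneg _
    · filter_upwards [self_mem_nhdsWithin] with t ht
      rw [tegExponent_comm]
      exact hlim hy t ht

end PairLaw

/-! ### The covariance formula for the pair law -/

lemma lintegral_Ioi_eq_mul_lintegral_comp_mul {x : ℝ} (hx : 0 < x) (g : ℝ → ℝ≥0∞) :
    ∫⁻ y in Ioi 0, g y = ∫⁻ w in Ioi 0, ENNReal.ofReal x * g (x * w) := by
  have himg : (fun w => x * w) '' Ioi (0 : ℝ) = Ioi 0 := by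
    rw [image_mul_left_Ioi hx, mul_zero]
  have h := lintegral_image_eq_lintegral_abs_deriv_mul (s := Ioi (0 : ℝ)) (f := fun w => x * w)
    (f' := fun _ => x) measurableSet_Ioi
    (fun w _ => by simpa using ((hasDerivAt_id w).const_mul x).hasDerivWithinAt)
    (fun u _ v _ huv => mul_left_cancel₀ hx.ne' huv) g
  rw [himg] at h
  simpa only [abs_of_pos hx] using h

lemma tegIntegrand_nonneg {a R ν w : ℝ} (hν : ν < 1 / 2) (ha0 : 0 ≤ a) (ha1 : a ≤ 1)
    (hR1 : -1 ≤ R) (hR2 : R < 1) (hw : 0 < w) : 0 ≤ tegIntegrand a R ν w := by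
  have h1 := tegT1_pos (R := R) ha0 ha1 hw
  have h2 := tegT2_nonneg ha0 ha1 hR1 hR2 hw
  have h3 := tegT3_nonneg ha0 hR1 hR2 hw
  have h4 := Real.Gamma_pos_of_pos (s := 2 * (1 - ν)) (by linarith)
  have h5 := Real.Gamma_pos_of_pos (s := 1 - 2 * ν) (by linarith)
  unfold tegIntegrand
  positivity

lemma measurable_tegIntegrand (a R ν : ℝ) : Measurable (tegIntegrand a R ν) := by
  unfold tegIntegrand tegT1 tegT2 tegT3 tegK
  fun_prop

/-- Integrating the density along the ray of slope `w` gives the integrand of the covariance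
formula: both terms are inverse Gamma integrals. -/
lemma lintegral_ray {a R ν w : ℝ} (hν : ν < 1 / 2) (ha0 : 0 ≤ a) (ha1 : a ≤ 1)
    (hR1 : -1 ≤ R) (hR2 : R < 1) (hw : 0 < w) :
    ∫⁻ x in Ioi (0 : ℝ), ENNReal.ofReal x *
      ENNReal.ofReal (|x| ^ ν * |x * w| ^ ν * tegDensity a R x (x * w))
      = ENNReal.ofReal (tegIntegrand a R ν w) := by
  have h1 := tegT1_pos (R := R) ha0 ha1 hw
  have h2 := tegT2_nonneg ha0 ha1 hR1 hR2 hw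
  have h3 := tegT3_nonneg ha0 hR1 hR2 hw
  have hA := lintegral_inverse_gamma (s := 2 * (1 - ν)) (by linarith) h1
  have hB := lintegral_inverse_gamma (s := 1 - 2 * ν) (by linarith) h1
  have hsplit : ∀ x ∈ Ioi (0 : ℝ), ENNReal.ofReal x *
      ENNReal.ofReal (|x| ^ ν * |x * w| ^ ν * tegDensity a R x (x * w))
      = ENNReal.ofReal (w ^ ν * tegT2 a R w) *
          ENNReal.ofReal (x ^ (-(2 * (1 - ν)) - 1) * Real.exp (-(tegT1 a R w / x)))
        + ENNReal.ofReal (w ^ ν * tegT3 a R w) *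
          ENNReal.ofReal (x ^ (-(1 - 2 * ν) - 1) * Real.exp (-(tegT1 a R w / x))) := by
    intro x hx
    have hx : 0 < x := hx
    rw [← ENNReal.ofReal_mul hx.le, ← ENNReal.ofReal_mul (by positivity),
      ← ENNReal.ofReal_mul (by positivity), ← ENNReal.ofReal_add (by positivity) (by positivity),
      tegDensity_scale hR2 hx hw, abs_of_pos hx, abs_of_pos (mul_pos hx hw),
      Real.mul_rpow hx.le hw.le,
      show -(2 * (1 - ν)) - 1 = ν + ν - (3 : ℕ) by push_cast; ring,
      show -(1 - 2 * ν) - 1 = ν + ν - (2 : ℕ) by push_cast; ring,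
      Real.rpow_sub_natCast hx.ne', Real.rpow_sub_natCast hx.ne', Real.rpow_add hx]
    congr 1
    field_simp
  rw [setLIntegral_congr_fun measurableSet_Ioi hsplit, lintegral_add_left (by fun_prop),
    lintegral_const_mul _ (by fun_prop), lintegral_const_mul _ (by fun_prop), hA, hB]
  have h4 := Real.Gamma_pos_of_pos (s := 2 * (1 - ν)) (by linarith)
  have h5 := Real.Gamma_pos_of_pos (s := 1 - 2 * ν) (by linarith)
  rw [← ENNReal.ofReal_mul (by positivity), ← ENNReal.ofReal_mul (by positivity),
    ← ENNReal.ofReal_add (by positivity) (by positivity), tegIntegrand]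
  congr 1
  rw [show -(2 * (1 - ν)) = 2 * (ν - 1) by ring, show -(1 - 2 * ν) = 2 * ν - 1 by ring]
  ring

section

variable {Ω : Type*} [MeasurableSpace Ω] {P : Measure Ω} [IsProbabilityMeasure P]
  {Y Z : Ω → ℝ} {a R ν : ℝ}

/-- The mixed moment `𝔼 |Y|^ν |Z|^ν` in polar-type coordinates `(x, w) = (Y, Z / Y)`. -/
lemma HasTEGPairLaw.lintegral_mul (h : HasTEGPairLaw P Y Z a R) (hν : ν < 1 / 2)
    (ha0 : 0 ≤ a) (ha1 : a ≤ 1) (hR1 : -1 ≤ R) (hR2 : R < 1) :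
    ∫⁻ ω, ENNReal.ofReal (|Y ω| ^ ν * |Z ω| ^ ν) ∂P
      = ∫⁻ w in Ioi 0, ENNReal.ofReal (tegIntegrand a R ν w) := by
  have hm : Measurable fun p : ℝ × ℝ => ENNReal.ofReal (|p.1| ^ ν * |p.2| ^ ν) := by fun_prop
  have hd := measurable_tegDensity a R
  have hpm := h.aemeasurable_fst.prodMk h.aemeasurable_snd
  calc ∫⁻ ω, ENNReal.ofReal (|Y ω| ^ ν * |Z ω| ^ ν) ∂P
      = ∫⁻ p, ENNReal.ofReal (|p.1| ^ ν * |p.2| ^ ν) ∂(P.map fun ω => (Y ω, Z ω)) :=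
        (lintegral_map' hm.aemeasurable hpm).symm
    _ = ∫⁻ x in Ioi 0, ∫⁻ y in Ioi 0,
          ENNReal.ofReal (|x| ^ ν * |y| ^ ν * tegDensity a R x y) := by
        rw [h.map_eq_withDensity ha0 ha1 hR1 hR2,
          lintegral_withDensity_eq_lintegral_mul _ hd.ennreal_ofReal hm,
          lintegral_prod _ (by fun_prop)]
        refine setLIntegral_congr_fun measurableSet_Ioi fun x hx => ?_
        refine setLIntegral_congr_fun measurableSet_Ioi fun y hy => ?_
        simp only [Pi.mul_apply]
        rw [mul_comm, ← ENNReal.ofReal_mul (by positivity)]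
    _ = ∫⁻ x in Ioi 0, ∫⁻ w in Ioi 0, ENNReal.ofReal x *
          ENNReal.ofReal (|x| ^ ν * |x * w| ^ ν * tegDensity a R x (x * w)) :=
        setLIntegral_congr_fun measurableSet_Ioi fun x hx =>
          lintegral_Ioi_eq_mul_lintegral_comp_mul hx _
    _ = ∫⁻ w in Ioi 0, ∫⁻ x in Ioi 0, ENNReal.ofReal x *
          ENNReal.ofReal (|x| ^ ν * |x * w| ^ ν * tegDensity a R x (x * w)) := by
        refine lintegral_lintegral_swap ?_
        have h1 : Measurable fun p : ℝ × ℝ => tegDensity a R p.1 (p.1 * p.2) :=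
          Measurable.comp (g := fun p : ℝ × ℝ => tegDensity a R p.1 p.2)
            (f := fun p : ℝ × ℝ => (p.1, p.1 * p.2)) hd (by fun_prop)
        have h2 : Measurable fun p : ℝ × ℝ => |p.1| ^ ν * |p.1 * p.2| ^ ν := by fun_prop
        exact (measurable_fst.ennreal_ofReal.mul (h2.mul h1).ennreal_ofReal).aemeasurable
    _ = ∫⁻ w in Ioi 0, ENNReal.ofReal (tegIntegrand a R ν w) :=
        setLIntegral_congr_fun measurableSet_Ioi fun w hw =>
          lintegral_ray hν ha0 ha1 hR1 hR2 hw

lemma memLp_abs_rpow_of_frechet (hν : ν < 1 / 2) (hY : AEMeasurable Y P)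
    (h : ∀ x, 0 < x → P {ω | Y ω ≤ x} = ENNReal.ofReal (Real.exp (-(1 / x)))) :
    MemLp (fun ω => |Y ω| ^ ν) 2 P := by
  have hm : AEStronglyMeasurable (fun ω => |Y ω| ^ ν) P :=
    ((by fun_prop : Measurable fun x : ℝ => |x| ^ ν).comp_aemeasurable hY).aestronglyMeasurable
  refine (memLp_two_iff_integrable_sq hm).2 ⟨hm.pow 2, ?_⟩
  rw [hasFiniteIntegral_iff_ofReal (ae_of_all _ fun ω => by positivity)]
  have : ∀ ω, (|Y ω| ^ ν) ^ 2 = |Y ω| ^ (2 * ν) := fun ω => by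
    rw [mul_comm, ← Real.rpow_mul_natCast (abs_nonneg _)]; norm_num
  simp only [this]
  rw [lintegral_abs_rpow_of_frechet hY h (by linarith)]
  exact ENNReal.ofReal_lt_top

lemma integral_abs_rpow_of_frechet (hν : ν < 1) (hY : AEMeasurable Y P)
    (h : ∀ x, 0 < x → P {ω | Y ω ≤ x} = ENNReal.ofReal (Real.exp (-(1 / x)))) :
    ∫ ω, |Y ω| ^ ν ∂P = Real.Gamma (1 - ν) := by
  have hm : AEStronglyMeasurable (fun ω => |Y ω| ^ ν) P :=
    ((by fun_prop : Measurable fun x : ℝ => |x| ^ ν).comp_aemeasurable hY).aestronglyMeasurable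
  rw [integral_eq_lintegral_of_nonneg_ae (ae_of_all _ fun ω => by positivity) hm,
    lintegral_abs_rpow_of_frechet hY h hν,
    ENNReal.toReal_ofReal (Real.Gamma_pos_of_pos (by linarith)).le]

lemma HasTEGPairLaw.hasTEGCovariance_of_lt_one (h : HasTEGPairLaw P Y Z a R)
    (hν : ν < 1 / 2) (ha0 : 0 ≤ a) (ha1 : a ≤ 1) (hR1 : -1 ≤ R) (hR2 : R < 1) :
    HasTEGCovariance P Y Z a R ν := by
  have hY := fun x (hx : 0 < x) => h.cdf_fst ha0 ha1 hR1 hR2.le hx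
  have hZ := fun x (hx : 0 < x) => h.symm.cdf_fst ha0 ha1 hR1 hR2.le hx
  have hYm := memLp_abs_rpow_of_frechet hν h.aemeasurable_fst hY
  have hZm := memLp_abs_rpow_of_frechet hν h.aemeasurable_snd hZ
  have hprod := h.lintegral_mul hν ha0 ha1 hR1 hR2
  have hint : Integrable (fun ω => |Y ω| ^ ν * |Z ω| ^ ν) P := hYm.integrable_mul hZm
  have hnn : 0 ≤ᵐ[volume.restrict (Ioi 0)] tegIntegrand a R ν :=
    (ae_restrict_iff' measurableSet_Ioi).2
      (ae_of_all _ fun w hw => tegIntegrand_nonneg hν ha0 ha1 hR1 hR2 hw)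
  have hmeas := (measurable_tegIntegrand a R ν).aestronglyMeasurable
    (μ := volume.restrict (Ioi 0))
  refine ⟨hYm, hZm, ⟨hmeas, ?_⟩, ?_⟩
  · rw [hasFiniteIntegral_iff_ofReal hnn, ← hprod, ← hasFiniteIntegral_iff_ofReal
      (ae_of_all _ fun ω => by positivity)]
    exact hint.2
  · rw [covariance_eq_sub hYm hZm,
      integral_abs_rpow_of_frechet (by linarith) h.aemeasurable_fst hY,
      integral_abs_rpow_of_frechet (by linarith) h.aemeasurable_snd hZ,
      integral_eq_lintegral_of_nonneg_ae hnn hmeas, ← hprod,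
      ← integral_eq_lintegral_of_nonneg_ae (ae_of_all _ fun ω => by positivity)
        hint.aestronglyMeasurable, sq]
    rfl

lemma tegIntegrand_zero_left (R R' ν w : ℝ) : tegIntegrand 0 R ν w = tegIntegrand 0 R' ν w := by
  simp [tegIntegrand, tegT1, tegT2, tegT3]

/-- The covariance formula for a pair with the law of the truncated extremal Gaussian model. When
`R = 1` the coordinates have to be independent (`a = 0`), and then `R` is immaterial. -/
theorem HasTEGPairLaw.hasTEGCovariance (h : HasTEGPairLaw P Y Z a R)
    (hν : ν < 1 / 2) (ha0 : 0 ≤ a) (ha1 : a ≤ 1) (hR1 : -1 ≤ R) (hR2 : R ≤ 1)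
    (hRa : R = 1 → a = 0) : HasTEGCovariance P Y Z a R ν := by
  rcases hR2.lt_or_eq with hR | hR
  · exact h.hasTEGCovariance_of_lt_one hν ha0 ha1 hR1 hR
  · obtain rfl := hRa hR
    have h' : HasTEGPairLaw P Y Z 0 0 :=
      ⟨h.aemeasurable_fst, h.aemeasurable_snd, fun x y hx hy => by
        rw [h.cdf x y hx hy]; simp [tegExponent]⟩
    have hc := h'.hasTEGCovariance_of_lt_one hν le_rfl zero_le_one (by norm_num) one_pos
    have he : tegIntegrand 0 R ν = tegIntegrand 0 0 ν :=
      funext fun w => tegIntegrand_zero_left R 0 ν w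
    exact ⟨hc.memLp_fst, hc.memLp_snd, he ▸ hc.integrableOn, he ▸ hc.covariance_eq⟩

end

lemma truncProfile_mem_Icc {r t : ℝ} (hr : 0 < r) (ht : 0 ≤ t) :
    truncProfile r t ∈ Icc (0 : ℝ) 1 :=
  ⟨le_max_right _ _, max_le (by have : 0 ≤ t / (2 * r) := by positivity
                                linarith) zero_le_one⟩

/-! ### The Laplace functional of a Poisson process -/

/-- The function `x ↦ e^{-x}` from `[0, ∞]` to `[0, 1]`, with `e^{-∞} = 0`. -/
def expNeg (x : ℝ≥0∞) : ℝ≥0∞ := EReal.exp (-(x : EReal))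

lemma continuous_expNeg : Continuous expNeg :=
  ENNReal.continuous_exp.comp (continuous_neg.comp continuous_coe_ennreal_ereal)

lemma measurable_expNeg : Measurable expNeg := continuous_expNeg.measurable

lemma expNeg_zero : expNeg 0 = 1 := by simp [expNeg]

lemma expNeg_add (x y : ℝ≥0∞) : expNeg (x + y) = expNeg x * expNeg y := by
  rw [expNeg, expNeg, expNeg, ← EReal.exp_add, EReal.coe_ennreal_add,
    EReal.neg_add (Or.inl (EReal.coe_ennreal_ne_bot x)) (Or.inr (EReal.coe_ennreal_ne_bot y)),
    sub_eq_add_neg]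

lemma expNeg_sum {ι : Type*} (s : Finset ι) (f : ι → ℝ≥0∞) :
    expNeg (∑ i ∈ s, f i) = ∏ i ∈ s, expNeg (f i) := by
  classical
  induction s using Finset.induction_on with
  | empty => simp [expNeg_zero]
  | insert i s hi ih => rw [Finset.sum_insert hi, Finset.prod_insert hi, expNeg_add, ih]

lemma expNeg_natCast_mul (c : ℝ≥0∞) (k : ℕ) : expNeg (c * k) = expNeg c ^ k := by
  have := expNeg_sum (Finset.range k) fun _ => c
  simpa [mul_comm] using this

lemma antitone_expNeg : Antitone expNeg := fun _ _ h =>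
  EReal.exp_monotone (EReal.neg_le_neg_iff.2 (EReal.coe_ennreal_le_coe_ennreal_iff.2 h))

lemma expNeg_le_one (x : ℝ≥0∞) : expNeg x ≤ 1 :=
  (antitone_expNeg (zero_le (a := x))).trans_eq expNeg_zero

lemma expNeg_lt_one {x : ℝ≥0∞} (hx : 0 < x) : expNeg x < 1 := by
  rw [expNeg, EReal.exp_lt_one_iff, EReal.neg_lt_zero]
  exact_mod_cast hx

lemma expNeg_ofReal {r : ℝ} (hr : 0 ≤ r) :
    expNeg (ENNReal.ofReal r) = ENNReal.ofReal (Real.exp (-r)) := by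
  rw [expNeg, EReal.coe_ennreal_ofReal, max_eq_left hr, ← EReal.coe_neg, EReal.exp_coe]

/-- The rate `-log (1 - y)` at which a point is deleted with probability `y`. -/
def deletionRate (y : ℝ≥0∞) : ℝ≥0∞ := (-(ENNReal.log (1 - y))).toENNReal

lemma measurable_deletionRate : Measurable deletionRate := by
  unfold deletionRate
  fun_prop

lemma expNeg_deletionRate (y : ℝ≥0∞) : expNeg (deletionRate y) = 1 - y := by
  have h : 0 ≤ -(ENNReal.log (1 - y)) := by
    rw [← EReal.neg_le_neg_iff, neg_neg, neg_zero, ← ENNReal.log_one]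
    exact ENNReal.log_monotone tsub_le_self
  rw [expNeg, deletionRate, EReal.coe_toENNReal h, neg_neg, ENNReal.exp_log]

lemma pointCount_eq_tsum {Ω F : Type*} (p : ℕ → Ω → F) (A : Set F) (ω : Ω) :
    ((pointCount p A ω : ℕ∞) : ℝ≥0∞) = ∑' i, A.indicator (fun _ => (1 : ℝ≥0∞)) (p i ω) := by
  rw [pointCount, ← ENNReal.tsum_set_one, tsum_subtype {i | p i ω ∈ A} (fun _ => (1 : ℝ≥0∞))]
  rfl

/-- The sum of a simple function over the points, grouped by the values of the function. -/
lemma tsum_simpleFunc_eq {Ω F : Type*} [MeasurableSpace F] (p : ℕ → Ω → F)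
    (s : SimpleFunc F ℝ≥0∞) (ω : Ω) :
    ∑' i, s (p i ω) = ∑ c ∈ s.range, c * ((pointCount p (s ⁻¹' {c}) ω : ℕ∞) : ℝ≥0∞) := by
  have hm : Measurable fun i => p i ω := measurable_of_countable _
  have h1 : ∑' i, s (p i ω) = ∫⁻ x, s x ∂(Measure.count.map fun i => p i ω) := by
    rw [lintegral_map s.measurable hm, lintegral_count]
  rw [h1, SimpleFunc.lintegral_eq_lintegral, SimpleFunc.lintegral]
  refine Finset.sum_congr rfl fun c _ => ?_
  rw [Measure.map_apply hm (s.measurableSet_fiber c),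
    Measure.count_apply (hm (s.measurableSet_fiber c))]
  rfl

section Poisson

variable {Ω F : Type*} [MeasurableSpace Ω] [MeasurableSpace F] {P : Measure Ω}
  {p : ℕ → Ω → F} {Λ : Measure F}

lemma IsPoissonPointProcess.measurable_pointCount (h : IsPoissonPointProcess P p Λ)
    {A : Set F} (hA : MeasurableSet A) : Measurable (pointCount p A) := by
  refine measurable_to_countable' fun k => ?_
  have hm : Measurable fun ω => ∑' i, A.indicator (fun _ => (1 : ℝ≥0∞)) (p i ω) :=
    Measurable.tsum fun i => (measurable_const.indicator hA).comp (h.measurable i)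
  have : pointCount p A ⁻¹' {k}
      = (fun ω => ∑' i, A.indicator (fun _ => (1 : ℝ≥0∞)) (p i ω)) ⁻¹' {(k : ℝ≥0∞)} := by
    ext ω
    simp only [mem_preimage, mem_singleton_iff, ← pointCount_eq_tsum, ENat.toENNReal_inj]
  rw [this]
  exact hm (measurableSet_singleton _)

variable [IsProbabilityMeasure P]

/-- The Laplace transform of a Poisson variable. -/
lemma IsPoissonPointProcess.lintegral_expNeg_count (h : IsPoissonPointProcess P p Λ)
    {A : Set F} (hA : MeasurableSet A) (hΛ : Λ A ≠ ∞) {c : ℝ≥0∞} (hc : c ≠ ∞) :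
    ∫⁻ ω, expNeg (c * ((pointCount p A ω : ℕ∞) : ℝ≥0∞)) ∂P = expNeg ((1 - expNeg c) * Λ A) := by
  set l := (Λ A).toReal with hl
  have hl0 : 0 ≤ l := ENNReal.toReal_nonneg
  have hmeas : ∀ k : ℕ, MeasurableSet {ω | pointCount p A ω = k} := fun k =>
    h.measurable_pointCount hA (measurableSet_singleton (k : ℕ∞))
  have hdisj : Pairwise (Function.onFun Disjoint fun k : ℕ => {ω | pointCount p A ω = k}) := by
    intro i j hij
    refine disjoint_left.2 fun ω hi hj => hij ?_
    have hi : pointCount p A ω = i := hi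
    have hj : pointCount p A ω = j := hj
    exact_mod_cast hi.symm.trans hj
  have hser : ∀ t : ℝ, HasSum (fun k : ℕ => Real.exp (-l) * l ^ k / (k ! : ℝ) * t ^ k)
      (Real.exp (-l) * Real.exp (l * t)) := fun t => by
    have := (NormedSpace.expSeries_div_hasSum_exp (l * t)).mul_left (Real.exp (-l))
    rw [← Real.exp_eq_exp_ℝ] at this
    refine this.congr_fun ?_
    intro k
    rw [mul_pow]; ring
  have hone : P (⋃ k : ℕ, {ω | pointCount p A ω = k}) = 1 := by
    rw [measure_iUnion hdisj hmeas]
    simp only [h.poisson A hA hΛ]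
    have := hser 1
    simp only [one_pow, mul_one] at this
    rw [← ENNReal.ofReal_tsum_of_nonneg (fun k => by positivity) this.summable, this.tsum_eq,
      ← Real.exp_add]
    simp
  have hae : (⋃ k : ℕ, {ω | pointCount p A ω = k}) =ᵐ[P] univ :=
    ae_eq_univ.2 ((prob_compl_eq_zero_iff (MeasurableSet.iUnion hmeas)).2 hone)
  obtain ⟨r, hr0, rfl⟩ : ∃ r : ℝ, 0 ≤ r ∧ c = ENNReal.ofReal r :=
    ⟨c.toReal, ENNReal.toReal_nonneg, (ENNReal.ofReal_toReal hc).symm⟩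
  rw [← setLIntegral_univ, ← setLIntegral_congr hae, lintegral_iUnion hmeas hdisj]
  have hterm : ∀ k : ℕ, ∫⁻ ω in {ω | pointCount p A ω = k},
      expNeg (ENNReal.ofReal r * ((pointCount p A ω : ℕ∞) : ℝ≥0∞)) ∂P
      = ENNReal.ofReal (Real.exp (-l) * l ^ k / (k ! : ℝ) * Real.exp (-r) ^ k) := by
    intro k
    have : ∀ ω ∈ {ω | pointCount p A ω = k},
        expNeg (ENNReal.ofReal r * ((pointCount p A ω : ℕ∞) : ℝ≥0∞))
        = ENNReal.ofReal (Real.exp (-r) ^ k) := fun ω hω => by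
      rw [show pointCount p A ω = k from hω, ENat.toENNReal_coe, expNeg_natCast_mul,
        expNeg_ofReal hr0, ENNReal.ofReal_pow (Real.exp_nonneg _)]
    rw [setLIntegral_congr_fun (hmeas k) this, setLIntegral_const, h.poisson A hA hΛ,
      ← ENNReal.ofReal_mul (by positivity), mul_comm]
  have := hser (Real.exp (-r))
  have hr1 : 0 ≤ 1 - Real.exp (-r) := sub_nonneg.2 (Real.exp_le_one_iff.2 (by linarith))
  rw [tsum_congr hterm, ← ENNReal.ofReal_tsum_of_nonneg (fun k => by positivity) this.summable,
    this.tsum_eq, ← Real.exp_add, expNeg_ofReal hr0, ← ENNReal.ofReal_one,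
    ← ENNReal.ofReal_sub _ (Real.exp_nonneg _), ← ENNReal.ofReal_toReal hΛ, ← hl,
    ← ENNReal.ofReal_mul hr1, expNeg_ofReal (mul_nonneg hr1 hl0)]
  congr 2; ring

lemma IsPoissonPointProcess.lintegral_expNeg_simpleFunc (h : IsPoissonPointProcess P p Λ)
    (s : SimpleFunc F ℝ≥0∞) (hs : ∀ x, s x ≠ ∞) (hΛ : ∀ c, c ≠ 0 → Λ (s ⁻¹' {c}) ≠ ∞) :
    ∫⁻ ω, expNeg (∑' i, s (p i ω)) ∂P = expNeg (∫⁻ x, 1 - expNeg (s x) ∂Λ) := by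
  classical
  let e := s.range.equivFin
  let A : Fin s.range.card → Set F := fun j => s ⁻¹' {(e.symm j : ℝ≥0∞)}
  have hA : ∀ j, MeasurableSet (A j) := fun j => s.measurableSet_fiber _
  have hdisj : Pairwise fun i j => Disjoint (A i) (A j) := fun i j hij =>
    disjoint_left.2 fun x hi hj => hij (e.symm.injective (Subtype.ext
      ((show s x = _ from hi).symm.trans hj)))
  have hind := h.indep _ A hA hdisj
  have hreindex : ∀ f : ℝ≥0∞ → ℝ≥0∞, ∏ c ∈ s.range, f c = ∏ j, f (e.symm j) := fun f => by
    rw [← Finset.prod_coe_sort s.range f]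
    exact (Equiv.prod_comp e.symm fun c : s.range => f c).symm
  have hind' := hind.comp (fun j (n : ℕ∞) => expNeg ((e.symm j : ℝ≥0∞) * (n : ℝ≥0∞)))
    fun j => measurable_from_top
  have hterm : ∀ c ∈ s.range,
      ∫⁻ ω, expNeg (c * ((pointCount p (s ⁻¹' {c}) ω : ℕ∞) : ℝ≥0∞)) ∂P
        = expNeg ((1 - expNeg c) * Λ (s ⁻¹' {c})) := by
    intro c hc
    rcases eq_or_ne c 0 with rfl | h0
    · simp [expNeg_zero]
    · obtain ⟨x, rfl⟩ := SimpleFunc.mem_range.1 hc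
      exact h.lintegral_expNeg_count (s.measurableSet_fiber _) (hΛ _ h0) (hs x)
  calc ∫⁻ ω, expNeg (∑' i, s (p i ω)) ∂P
      = ∫⁻ ω, ∏ j, expNeg ((e.symm j : ℝ≥0∞) * ((pointCount p (A j) ω : ℕ∞) : ℝ≥0∞)) ∂P := by
        refine lintegral_congr fun ω => ?_
        rw [tsum_simpleFunc_eq, expNeg_sum,
          hreindex fun c => expNeg (c * ((pointCount p (s ⁻¹' {c}) ω : ℕ∞) : ℝ≥0∞))]
    _ = ∏ j, ∫⁻ ω, expNeg ((e.symm j : ℝ≥0∞) * ((pointCount p (A j) ω : ℕ∞) : ℝ≥0∞)) ∂P :=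
        lintegral_prod_eq_prod_lintegral_of_indepFun Finset.univ _ hind'
          fun j => Measurable.comp (g := fun n : ℕ∞ => expNeg ((e.symm j : ℝ≥0∞) * (n : ℝ≥0∞)))
            measurable_from_top (h.measurable_pointCount (hA j))
    _ = ∏ c ∈ s.range, expNeg ((1 - expNeg c) * Λ (s ⁻¹' {c})) := by
        rw [hreindex fun c => expNeg ((1 - expNeg c) * Λ (s ⁻¹' {c}))]
        exact Finset.prod_congr rfl fun j _ => hterm _ (e.symm j).2
    _ = expNeg (∫⁻ x, 1 - expNeg (s x) ∂Λ) := by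
        rw [← expNeg_sum, ← SimpleFunc.map_lintegral (fun c => 1 - expNeg c),
          ← SimpleFunc.lintegral_eq_lintegral]
        rfl

/-- The Laplace functional of a Poisson process, by monotone approximation with simple
functions. -/
theorem IsPoissonPointProcess.lintegral_expNeg_tsum (h : IsPoissonPointProcess P p Λ)
    {f : F → ℝ≥0∞} (hf : Measurable f) (hfin : ∫⁻ x, 1 - expNeg (f x) ∂Λ ≠ ∞) :
    ∫⁻ ω, expNeg (∑' i, f (p i ω)) ∂P = expNeg (∫⁻ x, 1 - expNeg (f x) ∂Λ) := by
  set s : ℕ → SimpleFunc F ℝ≥0∞ := SimpleFunc.eapprox f with hs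
  have hsle : ∀ n x, s n x ≤ f x := fun n x => by
    rw [← SimpleFunc.iSup_eapprox_apply hf x]
    exact le_iSup (fun n => (SimpleFunc.eapprox f n : F → ℝ≥0∞) x) n
  have hone : Measurable fun x => 1 - expNeg (f x) :=
    measurable_const.sub (measurable_expNeg.comp hf)
  -- a level set of `s n` with positive value lies in a superlevel set of `1 - e^{-f}`
  have hlevel : ∀ n c, c ≠ 0 → Λ (s n ⁻¹' {c}) ≠ ∞ := fun n c hc => by
    have hpos : 1 - expNeg c ≠ 0 := (tsub_pos_iff_lt.2 (expNeg_lt_one (pos_iff_ne_zero.2 hc))).ne'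
    refine ne_top_of_le_ne_top (ENNReal.div_ne_top hfin hpos)
      ((measure_mono ?_).trans (meas_ge_le_lintegral_div hone.aemeasurable hpos ?_))
    · intro x hx
      have hx : s n x = c := hx
      exact tsub_le_tsub_left (antitone_expNeg (hx ▸ hsle n x)) 1
    · exact ne_top_of_le_ne_top ENNReal.one_ne_top tsub_le_self
  have happrox : ∀ n, ∫⁻ ω, expNeg (∑' i, s n (p i ω)) ∂P
      = expNeg (∫⁻ x, 1 - expNeg (s n x) ∂Λ) := fun n =>
    h.lintegral_expNeg_simpleFunc (s n) (fun x => (SimpleFunc.eapprox_lt_top f n x).ne)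
      (hlevel n)
  have hmono : ∀ x, Monotone fun n => s n x := fun x m n hmn =>
    SimpleFunc.monotone_eapprox f hmn x
  have hlim : ∀ x, Filter.Tendsto (fun n => s n x) Filter.atTop (nhds (f x)) := fun x =>
    SimpleFunc.tendsto_eapprox hf x
  have hR : Filter.Tendsto (fun n => expNeg (∫⁻ x, 1 - expNeg (s n x) ∂Λ)) Filter.atTop
      (nhds (expNeg (∫⁻ x, 1 - expNeg (f x) ∂Λ))) := by
    refine (continuous_expNeg.tendsto _).comp (lintegral_tendsto_of_tendsto_of_monotone
      (fun n => (measurable_const.sub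
        (measurable_expNeg.comp (s n).measurable)).aemeasurable)
      (ae_of_all _ fun x m n hmn => tsub_le_tsub_left (antitone_expNeg (hmono x hmn)) 1)
      (ae_of_all _ fun x => ?_))
    exact ENNReal.Tendsto.sub tendsto_const_nhds ((continuous_expNeg.tendsto _).comp (hlim x))
      (Or.inl ENNReal.one_ne_top)
  have hsum : ∀ ω, Filter.Tendsto (fun n => ∑' i, s n (p i ω)) Filter.atTop
      (nhds (∑' i, f (p i ω))) := fun ω => by
    simp only [← lintegral_count]
    exact lintegral_tendsto_of_tendsto_of_monotone
      (fun n => (measurable_of_countable _).aemeasurable)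
      (ae_of_all _ fun i => hmono _) (ae_of_all _ fun i => hlim _)
  have hLm : Filter.Tendsto (fun n => ∫⁻ ω, expNeg (∑' i, s n (p i ω)) ∂P) Filter.atTop
      (nhds (∫⁻ ω, expNeg (∑' i, f (p i ω)) ∂P)) := by
    refine tendsto_lintegral_of_dominated_convergence (fun _ => 1) (fun n => ?_)
      (fun n => ae_of_all _ fun ω => expNeg_le_one _) (by simp)
      (ae_of_all _ fun ω => (continuous_expNeg.tendsto _).comp (hsum ω))
    exact measurable_expNeg.comp
      (Measurable.tsum fun i => (s n).measurable.comp (h.measurable i))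
  simp only [happrox] at hLm
  exact tendsto_nhds_unique hLm hR

/-- If the point `p i` survives with conditional probability `1 - g (p i)`, then all points
survive with probability `exp (-∫ g dΛ)`. -/
theorem IsPoissonPointProcess.tendsto_lintegral_prod (h : IsPoissonPointProcess P p Λ)
    {g : F → ℝ≥0∞} (hg : Measurable g) (hg1 : ∀ x, g x ≤ 1) (hfin : ∫⁻ x, g x ∂Λ ≠ ∞) :
    Filter.Tendsto (fun n => ∫⁻ ω, ∏ i ∈ Finset.range n, (1 - g (p i ω)) ∂P) Filter.atTop
      (nhds (expNeg (∫⁻ x, g x ∂Λ))) := by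
  have hd : ∀ x, 1 - expNeg (deletionRate (g x)) = g x := fun x => by
    rw [expNeg_deletionRate, ENNReal.sub_sub_cancel ENNReal.one_ne_top (hg1 x)]
  have hm := measurable_deletionRate.comp hg
  have key := h.lintegral_expNeg_tsum hm (by simpa only [Function.comp, hd] using hfin)
  simp only [Function.comp, hd] at key
  rw [← key]
  have hprod : ∀ n ω, ∏ i ∈ Finset.range n, (1 - g (p i ω))
      = expNeg (∑ i ∈ Finset.range n, deletionRate (g (p i ω))) := fun n ω => by
    rw [expNeg_sum]
    exact Finset.prod_congr rfl fun i _ => (expNeg_deletionRate _).symm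
  simp only [hprod]
  refine tendsto_lintegral_of_dominated_convergence (fun _ => 1) (fun n => ?_)
    (fun n => ae_of_all _ fun ω => expNeg_le_one _) (by simp)
    (ae_of_all _ fun ω => (continuous_expNeg.tendsto _).comp
      (ENNReal.tendsto_nat_tsum fun i => deletionRate (g (p i ω))))
  exact measurable_expNeg.comp
    (Finset.measurable_fun_sum _ fun i _ => hm.comp (h.measurable i))

end Poisson

/-! ### Marked Poisson processes -/

section Marks

variable {Ω F M N : Type*} [MeasurableSpace Ω] [MeasurableSpace F] [MeasurableSpace M]
  [MeasurableSpace N] {P : Measure Ω} [IsProbabilityMeasure P]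

/-- Fubini's theorem for a function of two independent random elements. -/
lemma lintegral_comp_prodMk_of_indepFun {X : Ω → M} {Y : Ω → N} (hX : Measurable X)
    (hY : Measurable Y) (h : IndepFun X Y P) {f : M × N → ℝ≥0∞} (hf : Measurable f) :
    ∫⁻ ω, f (X ω, Y ω) ∂P = ∫⁻ ω, ∫⁻ ω', f (X ω, Y ω') ∂P ∂P := by
  have h1 := (indepFun_iff_map_prod_eq_prod_map_map hX.aemeasurable hY.aemeasurable).1 h
  have := Measure.isProbabilityMeasure_map (μ := P) hY.aemeasurable
  rw [← lintegral_map (f := f) hf (hX.prodMk hY), h1, lintegral_prod _ hf.aemeasurable,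
    lintegral_map hf.lintegral_prod_right' hX]
  exact lintegral_congr fun ω => lintegral_map (hf.comp measurable_prodMk_left) hY

/-- Two independent sequences of independent marks: expectations of products factorize. -/
lemma lintegral_prod_marks {U : ℕ → Ω → M} {V : ℕ → Ω → N} (hU : ∀ i, Measurable (U i))
    (hV : ∀ i, Measurable (V i)) (hUi : iIndepFun U P) (hVi : iIndepFun V P)
    (hUV : IndepFun (fun ω i => U i ω) (fun ω i => V i ω) P)
    {f : ℕ → M × N → ℝ≥0∞} (hfm : ∀ i, Measurable (f i)) (n : ℕ) :
    ∫⁻ ω, ∏ i ∈ Finset.range n, f i (U i ω, V i ω) ∂P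
      = ∏ i ∈ Finset.range n, ∫⁻ m, f i m ∂((P.map (U i)).prod (P.map (V i))) := by
  have hVp := fun i => Measure.isProbabilityMeasure_map (μ := P) (hV i).aemeasurable
  set k : ℕ → M → ℝ≥0∞ := fun i u => ∫⁻ v, f i (u, v) ∂P.map (V i) with hk
  have hkm : ∀ i, Measurable (k i) := fun i => (hfm i).lintegral_prod_right'
  calc ∫⁻ ω, ∏ i ∈ Finset.range n, f i (U i ω, V i ω) ∂P
      = ∫⁻ ω, ∫⁻ ω', ∏ i ∈ Finset.range n, f i (U i ω, V i ω') ∂P ∂P := by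
        refine lintegral_comp_prodMk_of_indepFun (X := fun ω i => U i ω) (Y := fun ω i => V i ω)
          (f := fun q : (ℕ → M) × (ℕ → N) => ∏ i ∈ Finset.range n, f i (q.1 i, q.2 i))
          (measurable_pi_lambda _ hU) (measurable_pi_lambda _ hV) hUV ?_
        exact Finset.measurable_fun_prod _ fun i _ => (hfm i).comp (by fun_prop)
    _ = ∫⁻ ω, ∏ i ∈ Finset.range n, k i (U i ω) ∂P := by
        refine lintegral_congr fun ω => ?_
        have hc : ∀ i, Measurable fun v => f i (U i ω, v) := fun i =>
          (hfm i).comp measurable_prodMk_left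
        rw [lintegral_prod_eq_prod_lintegral_of_indepFun _ (fun i ω' => f i (U i ω, V i ω'))
          (hVi.comp _ hc) fun i => (hc i).comp (hV i)]
        exact Finset.prod_congr rfl fun i _ => (lintegral_map (hc i) (hV i)).symm
    _ = ∏ i ∈ Finset.range n, ∫⁻ m, f i m ∂((P.map (U i)).prod (P.map (V i))) := by
        rw [lintegral_prod_eq_prod_lintegral_of_indepFun _ (fun i ω => k i (U i ω))
          (hUi.comp _ hkm) fun i => (hkm i).comp (hU i)]
        refine Finset.prod_congr rfl fun i _ => ?_
        rw [lintegral_prod _ (hfm i).aemeasurable, ← lintegral_map (hkm i) (hU i)]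

/-- The void probability of a marked Poisson process: the points `p i` carry independent marks
`(U i, V i)` with common law `μ ⊗ ν`, and no marked point falls into `A` with probability
`exp (-(Λ ⊗ μ ⊗ ν) A)`. -/
theorem IsPoissonPointProcess.measure_forall_notMem_marked {p : ℕ → Ω → F} {Λ : Measure F}
    (h : IsPoissonPointProcess P p Λ) {U : ℕ → Ω → M} {V : ℕ → Ω → N} {μ : Measure M}
    {ν : Measure N} (hU : ∀ i, Measurable (U i)) (hV : ∀ i, Measurable (V i))
    (hμ : ∀ i, P.map (U i) = μ) (hν : ∀ i, P.map (V i) = ν)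
    (hUi : iIndepFun U P) (hVi : iIndepFun V P)
    (hUV : IndepFun (fun ω i => U i ω) (fun ω i => V i ω) P)
    (hp : IndepFun (fun ω i => p i ω) (fun ω => ((fun i => U i ω), (fun i => V i ω))) P)
    {A : Set (F × (M × N))} (hA : MeasurableSet A)
    (hfin : ∫⁻ x, (μ.prod ν) (Prod.mk x ⁻¹' A) ∂Λ ≠ ∞) :
    P {ω | ∀ i, (p i ω, (U i ω, V i ω)) ∉ A}
      = expNeg (∫⁻ x, (μ.prod ν) (Prod.mk x ⁻¹' A) ∂Λ) := by
  have hμp : IsProbabilityMeasure μ := hμ 0 ▸ Measure.isProbabilityMeasure_map (hU 0).aemeasurable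
  have hνp : IsProbabilityMeasure ν := hν 0 ▸ Measure.isProbabilityMeasure_map (hV 0).aemeasurable
  have hm : ∀ i, Measurable fun ω => (p i ω, (U i ω, V i ω)) := fun i =>
    (h.measurable i).prodMk ((hU i).prodMk (hV i))
  have hind : Measurable (Aᶜ.indicator fun _ => (1 : ℝ≥0∞)) :=
    measurable_const.indicator hA.compl
  have hg := measurable_measure_prodMk_left (ν := μ.prod ν) hA
  have ht := h.tendsto_lintegral_prod hg (fun x => prob_le_one) hfin
  have hstep : ∀ n, ∫⁻ ω, ∏ i ∈ Finset.range n, (1 - (μ.prod ν) (Prod.mk (p i ω) ⁻¹' A)) ∂P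
      = P (⋂ i ∈ Finset.range n, {ω | (p i ω, (U i ω, V i ω)) ∉ A}) := by
    intro n
    have hset : MeasurableSet (⋂ i ∈ Finset.range n, {ω | (p i ω, (U i ω, V i ω)) ∉ A}) :=
      Finset.measurableSet_biInter _ fun i _ => hm i hA.compl
    rw [← lintegral_indicator_one hset]
    have hprod : ∀ ω, (⋂ i ∈ Finset.range n, {ω | (p i ω, (U i ω, V i ω)) ∉ A}).indicator 1 ω
        = ∏ i ∈ Finset.range n,
          Aᶜ.indicator (fun _ => (1 : ℝ≥0∞)) (p i ω, (U i ω, V i ω)) := by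
      intro ω
      by_cases hω : ∀ i ∈ Finset.range n, (p i ω, (U i ω, V i ω)) ∉ A
      · rw [indicator_of_mem (by simpa using hω), Finset.prod_eq_one]
        · rfl
        · intro i hi; rw [indicator_of_mem (hω i hi)]
      · rw [indicator_of_notMem (by simpa using hω)]
        push Not at hω
        obtain ⟨i, hi, hiA⟩ := hω
        exact (Finset.prod_eq_zero hi (indicator_of_notMem (notMem_compl_iff.2 hiA) _)).symm
    simp only [hprod]
    rw [lintegral_comp_prodMk_of_indepFun (X := fun ω i => p i ω)
      (Y := fun ω => ((fun i => U i ω), (fun i => V i ω)))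
      (f := fun q : (ℕ → F) × ((ℕ → M) × (ℕ → N)) => ∏ i ∈ Finset.range n,
        Aᶜ.indicator (fun _ => (1 : ℝ≥0∞)) (q.1 i, (q.2.1 i, q.2.2 i)))
      (measurable_pi_lambda _ h.measurable)
      ((measurable_pi_lambda _ hU).prodMk (measurable_pi_lambda _ hV)) hp
      (Finset.measurable_fun_prod _ fun i _ => hind.comp (by fun_prop))]
    refine lintegral_congr fun ω => ?_
    rw [lintegral_prod_marks hU hV hUi hVi hUV
      (f := fun i m => Aᶜ.indicator (fun _ => (1 : ℝ≥0∞)) (p i ω, m))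
      fun i => hind.comp measurable_prodMk_left]
    refine Finset.prod_congr rfl fun i _ => ?_
    have hAi : MeasurableSet (Prod.mk (p i ω) ⁻¹' A : Set (M × N)) := measurable_prodMk_left hA
    rw [hμ, hν, ← prob_compl_eq_one_sub hAi, ← lintegral_indicator_one hAi.compl]
    rfl
  simp only [hstep] at ht
  have hanti : Antitone fun n => ⋂ i ∈ Finset.range n, {ω | (p i ω, (U i ω, V i ω)) ∉ A} :=
    fun m n hmn => biInter_subset_biInter_left fun i hi =>
      Finset.range_mono hmn hi
  have hcont := tendsto_measure_iInter_atTop (μ := P)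
    (fun n => (Finset.measurableSet_biInter _ fun i _ => hm i hA.compl).nullMeasurableSet)
    hanti ⟨0, measure_ne_top _ _⟩
  rw [← tendsto_nhds_unique hcont ht]
  congr 1
  ext ω
  simp only [mem_ofPred_eq, mem_iInter, Finset.mem_range]
  exact ⟨fun hω n i _ => hω i, fun hω i => hω (i + 1) i (Nat.lt_succ_self i)⟩

end Marks

/-! ### Standard Gaussian pairs -/

/-- `μ` is the centred Gaussian law on the plane with unit variances and correlation `R`,
expressed through its one-dimensional projections. -/
def IsStdGaussianPair (μ : Measure (ℝ × ℝ)) (R : ℝ) : Prop :=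
  ∀ α β : ℝ, μ.map (fun p => α * p.1 + β * p.2)
    = gaussianReal 0 (α ^ 2 + 2 * α * β * R + β ^ 2).toNNReal

/-- The Cramér–Wold principle in the plane. -/
lemma ext_of_map_linear_combination {μ ν : Measure (ℝ × ℝ)} [IsFiniteMeasure μ]
    [IsFiniteMeasure ν]
    (h : ∀ α β : ℝ, μ.map (fun p => α * p.1 + β * p.2) = ν.map (fun p => α * p.1 + β * p.2)) :
    μ = ν := by
  refine Measure.ext_of_charFunDual (funext fun L => ?_)
  have hL : (L : ℝ × ℝ → ℝ) = fun p => L (1, 0) * p.1 + L (0, 1) * p.2 := by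
    funext p
    have hp : p = p.1 • ((1, 0) : ℝ × ℝ) + p.2 • ((0, 1) : ℝ × ℝ) := by ext <;> simp
    conv_lhs => rw [hp, map_add, map_smul, map_smul]
    simp only [smul_eq_mul]; ring
  rw [charFunDual_eq_charFun_map_one, charFunDual_eq_charFun_map_one, hL, h]

lemma IsStdGaussianPair.unique {μ ν : Measure (ℝ × ℝ)} [IsFiniteMeasure μ] [IsFiniteMeasure ν]
    {R : ℝ} (hμ : IsStdGaussianPair μ R) (hν : IsStdGaussianPair ν R) : μ = ν :=
  ext_of_map_linear_combination fun α β => (hμ α β).trans (hν α β).symm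

lemma IsStdGaussianPair.map_neg {μ : Measure (ℝ × ℝ)} {R : ℝ} (hμ : IsStdGaussianPair μ R) :
    IsStdGaussianPair (μ.map fun p => -p) R := fun α β => by
  rw [Measure.map_map (by fun_prop) (by fun_prop)]
  have := hμ (-α) (-β)
  simp only [neg_mul, neg_sq, mul_neg, neg_neg] at this
  rw [← this]
  congr 1
  funext p
  simp

lemma isStdGaussianPair_map {Ω : Type*} [MeasurableSpace Ω] {P : Measure Ω}
    [IsProbabilityMeasure P] {U V : Ω → ℝ} {R : ℝ} (hUm : Measurable U) (hVm : Measurable V)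
    (h : HasGaussianLaw (fun ω => (U ω, V ω)) P) (hU : ∫ ω, U ω ∂P = 0) (hV : ∫ ω, V ω ∂P = 0)
    (hUU : covariance U U P = 1) (hVV : covariance V V P = 1) (hUV : covariance U V P = R) :
    IsStdGaussianPair (P.map fun ω => (U ω, V ω)) R := fun α β => by
  rw [Measure.map_map (by fun_prop) (hUm.prodMk hVm)]
  have hlin : HasGaussianLaw (fun ω => α * U ω + β * V ω) P := by
    simpa using h.map_fun
      (α • ContinuousLinearMap.fst ℝ ℝ ℝ + β • ContinuousLinearMap.snd ℝ ℝ ℝ)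
  have hU2 := h.fst.memLp_two
  have hV2 := h.snd.memLp_two
  have hmean : ∫ ω, α * U ω + β * V ω ∂P = 0 := by
    rw [integral_add ((h.fst.integrable).const_mul α) ((h.snd.integrable).const_mul β),
      integral_const_mul, integral_const_mul, hU, hV]
    simp
  have hvar : Var[fun ω => α * U ω + β * V ω; P] = α ^ 2 + 2 * α * β * R + β ^ 2 := by
    rw [variance_fun_add (hU2.const_mul α) (hV2.const_mul β), variance_const_mul,
      variance_const_mul, covariance_const_mul_left, covariance_const_mul_right,
      ← covariance_self hUm.aemeasurable, ← covariance_self hVm.aemeasurable, hUU, hVV, hUV]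
    ring
  have := hlin.map_eq_gaussianReal
  rw [hmean, hvar] at this
  exact this

lemma abs_covariance_le_one {Ω : Type*} [MeasurableSpace Ω] {P : Measure Ω}
    [IsProbabilityMeasure P] {U V : Ω → ℝ} (hU : MemLp U 2 P) (hV : MemLp V 2 P)
    (hUU : covariance U U P = 1) (hVV : covariance V V P = 1) :
    |covariance U V P| ≤ 1 := by
  rw [covariance_self hU.aemeasurable] at hUU
  rw [covariance_self hV.aemeasurable] at hVV
  have h1 := variance_nonneg (U + V) P
  have h2 := variance_nonneg (U - V) P
  rw [variance_add hU hV, hUU, hVV] at h1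
  rw [variance_sub hU hV, hUU, hVV] at h2
  exact abs_le.2 ⟨by linarith, by linarith⟩

lemma integral_abs_gaussianReal_one : ∫ x, |x| ∂gaussianReal 0 1 = √(2 / Real.pi) := by
  have h2 : ∫ x in Ioi (0 : ℝ), x * Real.exp (-(1 / 2) * x ^ 2) = 1 := by
    have h := integral_rpow_mul_exp_neg_mul_rpow (p := 2) (q := 1) (b := 1 / 2) (by norm_num)
      (by norm_num) (by norm_num)
    norm_num at h
    refine Eq.trans ?_ h
    refine setIntegral_congr_fun measurableSet_Ioi fun x _ => ?_
    norm_num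
  rw [integral_gaussianReal_eq_integral_smul one_ne_zero]
  have h3 : ∀ x : ℝ, gaussianPDFReal 0 1 x • |x|
      = (√(2 * Real.pi))⁻¹ * (|x| * Real.exp (-(1 / 2) * |x| ^ 2)) := fun x => by
    simp only [gaussianPDFReal, NNReal.coe_one, mul_one, sub_zero, smul_eq_mul, sq_abs]
    rw [show -x ^ 2 / 2 = -(1 / 2) * x ^ 2 by ring]
    ring
  simp only [h3]
  rw [integral_const_mul, integral_comp_abs (f := fun x => x * Real.exp (-(1 / 2) * x ^ 2)), h2,
    mul_one, Real.sqrt_mul zero_le_two, Real.sqrt_div zero_le_two]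
  have : √2 * √2 = 2 := Real.mul_self_sqrt zero_le_two
  have h0 : 0 < √Real.pi := Real.sqrt_pos.2 Real.pi_pos
  field_simp
  linarith

lemma lintegral_abs_gaussianReal {σ : ℝ} (hσ : 0 ≤ σ) :
    ∫⁻ x, ENNReal.ofReal |x| ∂gaussianReal 0 (σ ^ 2).toNNReal
      = ENNReal.ofReal (√(2 / Real.pi) * σ) := by
  have h := gaussianReal_map_const_mul (μ := 0) (v := 1) σ
  rw [mul_zero, mul_one, ← Real.toNNReal_of_nonneg] at h
  rw [← h, lintegral_map (by fun_prop) (by fun_prop)]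
  have hi : Integrable (fun x : ℝ => |x|) (gaussianReal 0 1) :=
    ((memLp_id_gaussianReal' 1 (by simp)).integrable le_rfl).abs
  simp only [abs_mul, abs_of_nonneg hσ, ENNReal.ofReal_mul hσ]
  rw [lintegral_const_mul _ (by fun_prop), ← ofReal_integral_eq_lintegral_ofReal hi
    (ae_of_all _ fun x => abs_nonneg x), integral_abs_gaussianReal_one, ← ENNReal.ofReal_mul hσ,
    mul_comm]

lemma IsStdGaussianPair.lintegral_abs {μ : Measure (ℝ × ℝ)} {R : ℝ} (h : IsStdGaussianPair μ R)
    {α β : ℝ} (hq : 0 ≤ α ^ 2 + 2 * α * β * R + β ^ 2) :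
    ∫⁻ p, ENNReal.ofReal |α * p.1 + β * p.2| ∂μ
      = ENNReal.ofReal (√(2 / Real.pi) * √(α ^ 2 + 2 * α * β * R + β ^ 2)) := by
  rw [← lintegral_abs_gaussianReal (Real.sqrt_nonneg _), Real.sq_sqrt hq, ← h α β,
    lintegral_map (by fun_prop) (by fun_prop)]

lemma max_add_max_neg (x y : ℝ) :
    max (max x y) 0 + max (max (-x) (-y)) 0 = (|x| + |y| + |x - y|) / 2 := by
  rcases le_total x y with h1 | h1 <;> rcases le_total x 0 with h2 | h2 <;>
    rcases le_total y 0 with h3 | h3 <;>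
    simp [abs_of_nonneg, abs_of_nonpos, h1, h2, h3] <;> grind

/-- The mean of `max (α U, β V, 0)` for a standard Gaussian pair. By the symmetry of the law it is
half of the mean of the range `max (x, y, 0) - min (x, y, 0) = (|x| + |y| + |x - y|) / 2` of the
points `x = α U`, `y = β V` and `0`, so only absolute first moments are needed. -/
lemma IsStdGaussianPair.lintegral_max {μ : Measure (ℝ × ℝ)} [IsProbabilityMeasure μ] {R : ℝ}
    (h : IsStdGaussianPair μ R) (hR2 : R ≤ 1) {α β : ℝ} (hα : 0 ≤ α)
    (hβ : 0 ≤ β) :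
    ∫⁻ p, ENNReal.ofReal (max (max (α * p.1) (β * p.2)) 0) ∂μ
      = ENNReal.ofReal (√(2 / Real.pi) / 4 * (α + β + tegRoot R α β)) := by
  set I := ∫⁻ p, ENNReal.ofReal (max (max (α * p.1) (β * p.2)) 0) ∂μ with hI
  have hneg : I = ∫⁻ p, ENNReal.ofReal (max (max (-(α * p.1)) (-(β * p.2))) 0) ∂μ := by
    have := Measure.isProbabilityMeasure_map (μ := μ) (f := fun p => -p) (by fun_prop)
    rw [hI, h.unique h.map_neg, lintegral_map (by fun_prop) (by fun_prop), ← h.unique h.map_neg]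
    simp
  have h1 : ∫⁻ p, ENNReal.ofReal |α * p.1| ∂μ = ENNReal.ofReal (√(2 / Real.pi) * α) := by
    have := h.lintegral_abs (α := α) (β := 0) (by nlinarith [sq_nonneg α])
    simpa [Real.sqrt_sq hα] using this
  have h2 : ∫⁻ p, ENNReal.ofReal |β * p.2| ∂μ = ENNReal.ofReal (√(2 / Real.pi) * β) := by
    have := h.lintegral_abs (α := 0) (β := β) (by nlinarith [sq_nonneg β])
    simpa [Real.sqrt_sq hβ] using this
  have h3 : ∫⁻ p, ENNReal.ofReal |α * p.1 - β * p.2| ∂μ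
      = ENNReal.ofReal (√(2 / Real.pi) * tegRoot R α β) := by
    have hq : 0 ≤ α ^ 2 + 2 * α * (-β) * R + (-β) ^ 2 := by
      nlinarith [sq_nonneg (α - β), mul_nonneg (sub_nonneg.2 hR2) (mul_nonneg hα hβ)]
    have := h.lintegral_abs hq
    rw [show α ^ 2 + 2 * α * (-β) * R + (-β) ^ 2 = α ^ 2 - 2 * R * α * β + β ^ 2 by ring] at this
    simpa [tegRoot, sub_eq_add_neg] using this
  have hr : 0 ≤ tegRoot R α β := Real.sqrt_nonneg _
  have hsum : I + I = ENNReal.ofReal (1 / 2) * (ENNReal.ofReal (√(2 / Real.pi) * α)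
      + ENNReal.ofReal (√(2 / Real.pi) * β) + ENNReal.ofReal (√(2 / Real.pi) * tegRoot R α β)) := by
    conv_lhs => arg 2; rw [hneg]
    rw [hI, ← lintegral_add_left (by fun_prop), ← h1, ← h2, ← h3,
      ← lintegral_add_left (by fun_prop), ← lintegral_add_left (by fun_prop),
      ← lintegral_const_mul _ (by fun_prop)]
    refine lintegral_congr fun p => ?_
    rw [← ENNReal.ofReal_add (le_max_right _ _) (le_max_right _ _), max_add_max_neg,
      ← ENNReal.ofReal_add (abs_nonneg _) (abs_nonneg _),
      ← ENNReal.ofReal_add (by positivity) (abs_nonneg _), ← ENNReal.ofReal_mul (by norm_num)]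
    congr 1; ring
  rw [← ENNReal.ofReal_add (by positivity) (by positivity),
    ← ENNReal.ofReal_add (by positivity) (by positivity), ← ENNReal.ofReal_mul (by norm_num)]
    at hsum
  have hIfin : I ≠ ∞ := fun hT => by
    rw [hT, top_add] at hsum
    exact ENNReal.ofReal_ne_top hsum.symm
  rw [← ENNReal.ofReal_toReal hIfin, ← ENNReal.ofReal_add ENNReal.toReal_nonneg
    ENNReal.toReal_nonneg, ENNReal.ofReal_eq_ofReal_iff (by positivity) (by positivity)] at hsum
  rw [← ENNReal.ofReal_toReal hIfin]
  congr 1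
  linarith

/-! ### Random compact sets -/

section Compacts

variable {E : Type*} [MetricSpace E] [ProperSpace E] [MeasurableSpace E] [BorelSpace E]

/-- Membership `x ∈ B` is jointly measurable in the point and the compact set: `x ∉ B` holds iff
some ball, from a countable family of closed balls, contains `x` and misses `B`. -/
lemma measurableSet_mem_compacts :
    MeasurableSet {q : E × TopologicalSpace.Compacts E | q.1 ∈ (q.2 : Set E)} := by
  obtain ⟨S, hSc, hSd⟩ := TopologicalSpace.exists_countable_dense E
  have hmiss : ∀ K : Set E, IsCompact K →
      MeasurableSet {B : TopologicalSpace.Compacts E | ((B : Set E) ∩ K).Nonempty} := fun K hK =>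
    MeasurableSpace.measurableSet_generateFrom ⟨K, hK, rfl⟩
  have hcompl : {q : E × TopologicalSpace.Compacts E | q.1 ∈ (q.2 : Set E)}ᶜ
      = ⋃ x ∈ S, ⋃ r : ℚ, Metric.closedBall x r ×ˢ
        {B : TopologicalSpace.Compacts E | ((B : Set E) ∩ Metric.closedBall x r).Nonempty}ᶜ := by
    ext ⟨y, B⟩
    simp only [mem_compl_iff, mem_ofPred_eq, mem_iUnion, mem_prod, exists_prop,
      not_nonempty_iff_eq_empty]
    constructor
    · intro hy
      obtain ⟨ε, hε, hball⟩ := Metric.isOpen_iff.1 B.isCompact.isClosed.isOpen_compl y hy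
      obtain ⟨r, hr0, hr1⟩ := exists_rat_btwn (half_pos hε)
      obtain ⟨x, hx, hxy⟩ := Metric.dense_iff.1 hSd y r hr0
      refine ⟨x, hxy, r, ?_, ?_⟩
      · rw [Metric.mem_closedBall, dist_comm]
        exact (Metric.mem_ball.1 hx).le
      · refine eq_empty_of_forall_notMem fun z hz => hball ?_ hz.1
        have h1 := Metric.mem_closedBall.1 hz.2
        have h2 := Metric.mem_ball.1 hx
        rw [Metric.mem_ball]
        linarith [dist_triangle z x y]
    · rintro ⟨x, -, r, hyr, hempty⟩ hyB
      exact (Set.ext_iff.1 hempty y).1 ⟨hyB, hyr⟩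
  rw [← MeasurableSet.compl_iff, hcompl]
  exact MeasurableSet.biUnion hSc fun x _ => MeasurableSet.iUnion fun r =>
    Metric.isClosed_closedBall.measurableSet.prod
      (hmiss _ (isCompact_closedBall x r)).compl

end Compacts

section Overlap

variable {d : ℕ}

local notation "𝔼d" => EuclideanSpace ℝ (Fin d)

/-- The volume of the intersection of a compact set with its translate by `h`. -/
def overlapVolume (h : 𝔼d) (B : TopologicalSpace.Compacts 𝔼d) : ℝ≥0∞ :=
  volume ((B : Set 𝔼d) ∩ (fun x => h + x) '' (B : Set 𝔼d))

/-- The centres for which the truncation set, placed at the centre, covers `s`. -/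
def coveringCentres (s : 𝔼d) (B : TopologicalSpace.Compacts 𝔼d) : Set 𝔼d :=
  {c | s - c ∈ (B : Set 𝔼d)}

lemma measurableSet_coveringCentres_prod (s : 𝔼d) :
    MeasurableSet {q : 𝔼d × TopologicalSpace.Compacts 𝔼d | q.1 ∈ coveringCentres s q.2} :=
  Measurable.comp (g := fun q : 𝔼d × TopologicalSpace.Compacts 𝔼d => q)
    (f := fun q : 𝔼d × TopologicalSpace.Compacts 𝔼d => (s - q.1, q.2)) measurable_id (by fun_prop)
    measurableSet_mem_compacts

lemma measurableSet_coveringCentres (s : 𝔼d) (B : TopologicalSpace.Compacts 𝔼d) :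
    MeasurableSet (coveringCentres s B) :=
  measurable_prodMk_right (y := B) (measurableSet_coveringCentres_prod s)

lemma volume_coveringCentres (s : 𝔼d) (B : TopologicalSpace.Compacts 𝔼d) :
    volume (coveringCentres s B) = volume (B : Set 𝔼d) :=
  (Measure.measurePreserving_sub_left volume s).measure_preimage
    B.isCompact.isClosed.measurableSet.nullMeasurableSet

lemma volume_coveringCentres_inter (s h : 𝔼d) (B : TopologicalSpace.Compacts 𝔼d) :
    volume (coveringCentres s B ∩ coveringCentres (s + h) B) = overlapVolume h B := by
  have hB : MeasurableSet (B : Set 𝔼d) := B.isCompact.isClosed.measurableSet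
  have himg : MeasurableSet ((fun x => h + x) '' (B : Set 𝔼d)) :=
    (B.isCompact.image (by fun_prop)).isClosed.measurableSet
  rw [overlapVolume, ← (Measure.measurePreserving_sub_left volume (s + h)).measure_preimage
    (hB.inter himg).nullMeasurableSet]
  congr 1
  ext c
  simp only [coveringCentres, mem_inter_iff, mem_ofPred_eq, mem_preimage, mem_image]
  constructor
  · rintro ⟨h1, h2⟩
    exact ⟨h2, s - c, h1, by abel⟩
  · rintro ⟨h2, x, hx, hxe⟩
    refine ⟨?_, h2⟩
    have : s - c = x := by
      have : x = s + h - c - h := by rw [← hxe]; abel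
      rw [this]; abel
    rwa [this]

lemma overlapVolume_le (h : 𝔼d) (B : TopologicalSpace.Compacts 𝔼d) :
    overlapVolume h B ≤ volume (B : Set 𝔼d) := measure_mono inter_subset_left

lemma measurable_volume_compacts :
    Measurable fun B : TopologicalSpace.Compacts 𝔼d => volume (B : Set 𝔼d) :=
  measurable_measure_prodMk_right (μ := (volume : Measure 𝔼d)) measurableSet_mem_compacts

lemma measurable_overlapVolume (h : 𝔼d) : Measurable fun B => overlapVolume h B := by
  have := measurable_measure_prodMk_right (μ := (volume : Measure 𝔼d))
    ((measurableSet_coveringCentres_prod (0 : 𝔼d)).inter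
      (measurableSet_coveringCentres_prod (0 + h)))
  simp only [← volume_coveringCentres_inter 0 h]
  exact this

lemma overlapRatio_mem_Icc {Ω : Type*} [MeasurableSpace Ω] {P : Measure Ω}
    (B : Ω → TopologicalSpace.Compacts 𝔼d) (h : 𝔼d) (hfin : meanVolume P B ≠ ∞) :
    overlapRatio P B h ∈ Icc (0 : ℝ) 1 := by
  refine ⟨by unfold overlapRatio; positivity, div_le_one_of_le₀ ?_ ENNReal.toReal_nonneg⟩
  exact ENNReal.toReal_mono hfin (lintegral_mono fun ω => overlapVolume_le h (B ω))

end Overlap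

/-! ### Overlap of intervals -/

/-- In dimension one a ball of radius `r` and its translate by `h` overlap in an interval of
length `(2 r - ‖h‖)₊`. -/
lemma overlapVolume_closedBall {r : ℝ} (h : EuclideanSpace ℝ (Fin 1))
    {B : TopologicalSpace.Compacts (EuclideanSpace ℝ (Fin 1))}
    (hB : (B : Set (EuclideanSpace ℝ (Fin 1))) = Metric.closedBall 0 r) :
    overlapVolume h B = ENNReal.ofReal (2 * r - ‖h‖) := by
  let e := (OrthonormalBasis.singleton (Fin 1) ℝ).repr
  have he : MeasurePreserving e := e.measurePreserving
  have hm : MeasurableSet (Metric.closedBall (0 : EuclideanSpace ℝ (Fin 1)) r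
      ∩ Metric.closedBall h r) :=
    Metric.isClosed_closedBall.measurableSet.inter Metric.isClosed_closedBall.measurableSet
  have himg : (fun x => h + x) '' Metric.closedBall (0 : EuclideanSpace ℝ (Fin 1)) r
      = Metric.closedBall h r := by
    rw [image_add_left, preimage_add_closedBall]
    simp
  have hpre : ∀ x : EuclideanSpace ℝ (Fin 1),
      e ⁻¹' Metric.closedBall x r = Metric.closedBall (e.symm x) r := fun x => by
    ext y
    rw [mem_preimage, Metric.mem_closedBall, Metric.mem_closedBall, ← e.dist_map, e.apply_symm_apply]
    rfl
  have hnorm : ‖h‖ = |e.symm h| := by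
    rw [← Real.norm_eq_abs, e.symm.norm_map]; rfl
  rw [overlapVolume, hB, himg, ← he.measure_preimage hm.nullMeasurableSet, preimage_inter, hpre,
    hpre, e.symm.map_zero, Real.closedBall_eq_Icc, Real.closedBall_eq_Icc, Icc_inter_Icc,
    Real.volume_Icc, hnorm]
  congr 1
  rcases le_total 0 (e.symm h) with h0 | h0
  · rw [abs_of_nonneg h0, inf_eq_left.2 (by linarith), sup_eq_right.2 (by linarith)]; ring
  · rw [abs_of_nonpos h0, inf_eq_right.2 (by linarith), sup_eq_left.2 (by linarith)]; ring

lemma overlapRatio_closedBall {Ω : Type*} [MeasurableSpace Ω] {P : Measure Ω}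
    [IsProbabilityMeasure P] {B : Ω → TopologicalSpace.Compacts (EuclideanSpace ℝ (Fin 1))}
    {r : ℝ} (hr : 0 < r) (h : EuclideanSpace ℝ (Fin 1))
    (hB : ∀ᵐ ω ∂P, (B ω : Set (EuclideanSpace ℝ (Fin 1))) = Metric.closedBall 0 r) :
    overlapRatio P B h = truncProfile r ‖h‖ := by
  have h1 : ∫⁻ ω, overlapVolume h (B ω) ∂P = ENNReal.ofReal (2 * r - ‖h‖) := by
    rw [lintegral_congr_ae (hB.mono fun ω hω => overlapVolume_closedBall h hω)]
    simp
  have h2 : meanVolume P B = ENNReal.ofReal (2 * r) := by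
    have : ∀ᵐ ω ∂P, volume (B ω : Set (EuclideanSpace ℝ (Fin 1))) = ENNReal.ofReal (2 * r) :=
      hB.mono fun ω hω => by
        have := overlapVolume_closedBall (0 : EuclideanSpace ℝ (Fin 1)) hω
        simpa [overlapVolume] using this
    rw [meanVolume, lintegral_congr_ae this]
    simp
  have h3 : overlapRatio P B h
      = (∫⁻ ω, overlapVolume h (B ω) ∂P).toReal / (meanVolume P B).toReal := rfl
  have hr2 : 0 < 2 * r := by positivity
  rw [h3, h1, h2, ENNReal.toReal_ofReal hr2.le, truncProfile, ENNReal.toReal_ofReal',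
    ← max_div_div_right hr2.le, zero_div, sub_div, div_self hr2.ne']

/-! ### The exponent measure of the spectral representation -/

lemma frechetIntensity_setOf_one_lt_mul {t : ℝ} (ht : 0 ≤ t) :
    frechetIntensity {x | 0 < x ∧ 1 < x * t} = ENNReal.ofReal t := by
  rcases ht.eq_or_lt with rfl | ht
  · have : {x : ℝ | 0 < x ∧ 1 < x * 0} = ∅ := by
      ext x; simp
    rw [this]; simp
  have hset : {x : ℝ | 0 < x ∧ 1 < x * t} = Ioi t⁻¹ := by
    ext x
    simp only [mem_ofPred_eq, mem_Ioi, inv_lt_iff_one_lt_mul₀ ht]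
    exact ⟨fun h => h.2, fun h => ⟨by by_contra hx; nlinarith, h⟩⟩
  have hpos : 0 < t⁻¹ := inv_pos.2 ht
  have hint := integrableOn_Ioi_rpow_of_lt (a := -2) (by norm_num) hpos
  rw [hset, frechetIntensity, withDensity_apply _ measurableSet_Ioi,
    Measure.restrict_restrict measurableSet_Ioi, inter_eq_left.2 (Ioi_subset_Ioi hpos.le)]
  have hcongr : ∀ x ∈ Ioi t⁻¹, ENNReal.ofReal (1 / x ^ 2) = ENNReal.ofReal (x ^ (-2 : ℝ)) := by
    intro x hx
    have hx : 0 < x := hpos.trans hx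
    rw [Real.rpow_neg hx.le, one_div]
    norm_num
  rw [setLIntegral_congr_fun measurableSet_Ioi hcongr,
    ← ofReal_integral_eq_lintegral_ofReal hint ((ae_restrict_iff' measurableSet_Ioi).2
      (ae_of_all _ fun x hx => Real.rpow_nonneg (hpos.trans hx).le _)),
    integral_Ioi_rpow_of_lt (by norm_num) hpos]
  norm_num [Real.rpow_neg_one]

section Exceedance

variable {d : ℕ}

local notation "𝔼d" => EuclideanSpace ℝ (Fin d)

/-- The value at `s` of the spectral function with point `(ξ, c)`, Gaussian value `w` and
truncation set `B`, scaled by `C`. -/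
def tegSpectral (C : ℝ) (s : 𝔼d) (p : ℝ × 𝔼d) (w : ℝ)
    (B : TopologicalSpace.Compacts 𝔼d) : ℝ :=
  C * (p.1 * max w 0 * indicator (B : Set 𝔼d) (fun _ => (1 : ℝ)) (s - p.2))

/-- The marked points whose spectral function exceeds `x₁` at `s` or `x₂` at `s + h`. -/
def exceedanceSet (C : ℝ) (s h : 𝔼d) (x₁ x₂ : ℝ) :
    Set ((ℝ × 𝔼d) × ((ℝ × ℝ) × TopologicalSpace.Compacts 𝔼d)) :=
  {q | x₁ < tegSpectral C s q.1 q.2.1.1 q.2.2 ∨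
    x₂ < tegSpectral C (s + h) q.1 q.2.1.2 q.2.2}

lemma measurable_tegSpectral (C : ℝ) (s : 𝔼d) :
    Measurable fun q : (ℝ × 𝔼d) × (ℝ × TopologicalSpace.Compacts 𝔼d) =>
      tegSpectral C s q.1 q.2.1 q.2.2 := by
  have hind : Measurable fun q : 𝔼d × TopologicalSpace.Compacts 𝔼d =>
      indicator (q.2 : Set 𝔼d) (fun _ => (1 : ℝ)) (s - q.1) :=
    measurable_const.indicator (measurableSet_coveringCentres_prod s)
  have hind' : Measurable fun q : (ℝ × 𝔼d) × (ℝ × TopologicalSpace.Compacts 𝔼d) =>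
      indicator (q.2.2 : Set 𝔼d) (fun _ => (1 : ℝ)) (s - q.1.2) :=
    Measurable.comp (g := fun q : 𝔼d × TopologicalSpace.Compacts 𝔼d =>
      indicator (q.2 : Set 𝔼d) (fun _ => (1 : ℝ)) (s - q.1))
      (f := fun q : (ℝ × 𝔼d) × (ℝ × TopologicalSpace.Compacts 𝔼d) => (q.1.2, q.2.2))
      hind (by fun_prop)
  unfold tegSpectral
  exact measurable_const.mul ((by fun_prop : Measurable
    fun q : (ℝ × 𝔼d) × (ℝ × TopologicalSpace.Compacts 𝔼d) => q.1.1 * max q.2.1 0).mul hind')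

lemma measurableSet_exceedanceSet (C : ℝ) (s h : 𝔼d) (x₁ x₂ : ℝ) :
    MeasurableSet (exceedanceSet C s h x₁ x₂) := by
  have h1 := (measurable_tegSpectral C s).comp
    (f := fun q : (ℝ × 𝔼d) × ((ℝ × ℝ) × TopologicalSpace.Compacts 𝔼d) =>
      (q.1, (q.2.1.1, q.2.2))) (by fun_prop)
  have h2 := (measurable_tegSpectral C (s + h)).comp
    (f := fun q : (ℝ × 𝔼d) × ((ℝ × ℝ) × TopologicalSpace.Compacts 𝔼d) =>
      (q.1, (q.2.1.2, q.2.2))) (by fun_prop)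
  exact (measurableSet_lt measurable_const h1).union (measurableSet_lt measurable_const h2)

/-- The weight with which the truncation set `B` centred at `c` contributes at `s`. -/
def coverWeight (s : 𝔼d) (B : TopologicalSpace.Compacts 𝔼d) (c : 𝔼d) : ℝ :=
  (coveringCentres s B).indicator (fun _ => 1) c

lemma coverWeight_nonneg (s : 𝔼d) (B : TopologicalSpace.Compacts 𝔼d) (c : 𝔼d) :
    0 ≤ coverWeight s B c := indicator_nonneg (fun _ _ => zero_le_one) _

lemma measurable_coverWeight (s : 𝔼d) (B : TopologicalSpace.Compacts 𝔼d) :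
    Measurable (coverWeight s B) :=
  measurable_const.indicator (measurableSet_coveringCentres s B)

/-- Exceedance of a single level, normalized: the factor `ξ` has to beat a threshold. -/
lemma lt_tegSpectral_iff {C x : ℝ} (hC : 0 ≤ C) (hx : 0 < x) (s : 𝔼d) (p : ℝ × 𝔼d) (w : ℝ)
    (B : TopologicalSpace.Compacts 𝔼d) :
    x < tegSpectral C s p w B ↔
      0 < p.1 ∧ 1 < p.1 * max (C / x * coverWeight s B p.2 * w) 0 := by
  have hk := coverWeight_nonneg s B p.2
  have hmax : max (C / x * coverWeight s B p.2 * w) 0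
      = C / x * coverWeight s B p.2 * max w 0 := by
    rw [mul_max_of_nonneg _ _ (by positivity), mul_zero]
  have hval : tegSpectral C s p w B = x * (p.1 * max (C / x * coverWeight s B p.2 * w) 0) := by
    rw [hmax, tegSpectral]
    have : indicator (B : Set 𝔼d) (fun _ => (1 : ℝ)) (s - p.2) = coverWeight s B p.2 := rfl
    rw [this]
    field_simp
  rw [hval, lt_mul_iff_one_lt_right hx]
  refine ⟨fun h => ⟨?_, h⟩, fun h => h.2⟩
  by_contra hp
  have := mul_nonpos_of_nonpos_of_nonneg (not_lt.1 hp)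
    (le_max_right (C / x * coverWeight s B p.2 * w) 0)
  linarith

lemma frechetIntensity_exceedanceSet {C x₁ x₂ : ℝ} (hC : 0 ≤ C) (h₁ : 0 < x₁) (h₂ : 0 < x₂)
    (s h : 𝔼d) (w : ℝ × ℝ) (B : TopologicalSpace.Compacts 𝔼d) (c : 𝔼d) :
    frechetIntensity {ξ | ((ξ, c), (w, B)) ∈ exceedanceSet C s h x₁ x₂}
      = ENNReal.ofReal (max (max (C / x₁ * coverWeight s B c * w.1)
        (C / x₂ * coverWeight (s + h) B c * w.2)) 0) := by
  rw [← frechetIntensity_setOf_one_lt_mul (le_max_right _ _)]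
  congr 1
  ext ξ
  simp only [exceedanceSet, mem_ofPred_eq, lt_tegSpectral_iff hC h₁, lt_tegSpectral_iff hC h₂,
    ← and_or_left]
  refine and_congr_right fun hξ => ?_
  rw [← lt_max_iff, ← mul_max_of_nonneg _ _ hξ.le, max_max_max_comm, max_self]

lemma lintegral_coverWeight {R C x₁ x₂ : ℝ} (hC : 0 ≤ C) (h₁ : 0 < x₁) (h₂ : 0 < x₂)
    (hR1 : -1 ≤ R) (s h : 𝔼d) (B : TopologicalSpace.Compacts 𝔼d) :
    (∫⁻ c, ENNReal.ofReal (C / x₁ * coverWeight s B c + C / x₂ * coverWeight (s + h) B c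
        + tegRoot R (C / x₁ * coverWeight s B c) (C / x₂ * coverWeight (s + h) B c)))
      + ENNReal.ofReal (C / x₁ + C / x₂ - tegRoot R (C / x₁) (C / x₂)) * overlapVolume h B
      = ENNReal.ofReal (2 * (C / x₁ + C / x₂)) * volume (B : Set 𝔼d) := by
  set u := C / x₁ with hu
  set v := C / x₂ with hv
  have hu0 : 0 ≤ u := by positivity
  have hv0 : 0 ≤ v := by positivity
  have hle : 0 ≤ u + v - tegRoot R u v := sub_nonneg.2 (tegRoot_le_add hR1 hu0 hv0)
  have hD := measurableSet_coveringCentres s B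
  have hD' := measurableSet_coveringCentres (s + h) B
  have hm := measurable_coverWeight s B
  have hm' := measurable_coverWeight (s + h) B
  have hroot : Measurable fun c => ENNReal.ofReal (u * coverWeight s B c
      + v * coverWeight (s + h) B c
      + tegRoot R (u * coverWeight s B c) (v * coverWeight (s + h) B c)) := by
    unfold tegRoot; fun_prop
  have e1 : ENNReal.ofReal (u + v - tegRoot R u v) * overlapVolume h B
      = ∫⁻ c, (coveringCentres s B ∩ coveringCentres (s + h) B).indicator
        (fun _ => ENNReal.ofReal (u + v - tegRoot R u v)) c := by
    rw [lintegral_indicator_const (hD.inter hD'), volume_coveringCentres_inter]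
  have e2 : ENNReal.ofReal (2 * (u + v)) * volume (B : Set 𝔼d)
      = ∫⁻ c, ((coveringCentres s B).indicator (fun _ => ENNReal.ofReal (2 * u)) c
        + (coveringCentres (s + h) B).indicator (fun _ => ENNReal.ofReal (2 * v)) c) := by
    rw [lintegral_add_left (measurable_const.indicator hD), lintegral_indicator_const hD,
      lintegral_indicator_const hD', volume_coveringCentres, volume_coveringCentres, ← add_mul,
      ← ENNReal.ofReal_add (by positivity) (by positivity), mul_add]
  rw [e1, e2, ← lintegral_add_left hroot]
  refine lintegral_congr fun c => ?_
  have hu1 : tegRoot R u 0 = u := by simp [tegRoot, Real.sqrt_sq hu0]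
  have hv1 : tegRoot R 0 v = v := by simp [tegRoot, Real.sqrt_sq hv0]
  have h00 : tegRoot R 0 0 = 0 := by simp [tegRoot]
  have hr : 0 ≤ tegRoot R u v := Real.sqrt_nonneg _
  unfold coverWeight
  by_cases hc : c ∈ coveringCentres s B <;> by_cases hc' : c ∈ coveringCentres (s + h) B
  · rw [indicator_of_mem hc, indicator_of_mem hc', indicator_of_mem (mem_inter hc hc'),
      indicator_of_mem hc, indicator_of_mem hc',
      mul_one, mul_one, ← ENNReal.ofReal_add (by positivity) hle,
      ← ENNReal.ofReal_add (by positivity) (by positivity)]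
    congr 1; ring
  · rw [indicator_of_mem hc, indicator_of_notMem hc', indicator_of_notMem (fun hh => hc' hh.2),
      indicator_of_mem hc, indicator_of_notMem hc', mul_one, mul_zero, hu1, add_zero, add_zero,
      add_zero, two_mul]
  · rw [indicator_of_notMem hc, indicator_of_mem hc', indicator_of_notMem (fun hh => hc hh.1),
      indicator_of_notMem hc, indicator_of_mem hc', mul_one, mul_zero, hv1, zero_add, zero_add,
      add_zero, two_mul]
  · rw [indicator_of_notMem hc, indicator_of_notMem hc', indicator_of_notMem (fun hh => hc hh.1),
      indicator_of_notMem hc, indicator_of_notMem hc', mul_zero, mul_zero, h00]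
    simp

/-- The intensity of exceedances, in terms of the mean volume and the mean overlap. -/
lemma lintegral_exceedanceSet {μ : Measure (ℝ × ℝ)} [IsProbabilityMeasure μ] {R : ℝ}
    (hμ : IsStdGaussianPair μ R) (hR1 : -1 ≤ R) (hR2 : R ≤ 1)
    (ν : Measure (TopologicalSpace.Compacts 𝔼d)) [IsProbabilityMeasure ν]
    {C x₁ x₂ : ℝ} (hC : 0 ≤ C) (h₁ : 0 < x₁) (h₂ : 0 < x₂) (s h : 𝔼d) :
    (∫⁻ p, (μ.prod ν) (Prod.mk p ⁻¹' exceedanceSet C s h x₁ x₂)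
        ∂(frechetIntensity.prod volume))
      + ENNReal.ofReal (√(2 / Real.pi) / 4) *
        (ENNReal.ofReal (C / x₁ + C / x₂ - tegRoot R (C / x₁) (C / x₂)) *
          ∫⁻ B, overlapVolume h B ∂ν)
      = ENNReal.ofReal (√(2 / Real.pi) / 4) * (ENNReal.ofReal (2 * (C / x₁ + C / x₂)) *
        ∫⁻ B, volume (B : Set 𝔼d) ∂ν) := by
  have hA := measurableSet_exceedanceSet C s h x₁ x₂
  have : SFinite frechetIntensity := by unfold frechetIntensity; infer_instance
  have hcw : ∀ (t : 𝔼d) B c, 0 ≤ coverWeight t B c := coverWeight_nonneg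
  have hmean : ∫⁻ p, (μ.prod ν) (Prod.mk p ⁻¹' exceedanceSet C s h x₁ x₂)
        ∂(frechetIntensity.prod volume)
      = ENNReal.ofReal (√(2 / Real.pi) / 4) * ∫⁻ B, (∫⁻ c,
        ENNReal.ofReal (C / x₁ * coverWeight s B c + C / x₂ * coverWeight (s + h) B c
        + tegRoot R (C / x₁ * coverWeight s B c) (C / x₂ * coverWeight (s + h) B c))) ∂ν := by
    rw [← Measure.prod_apply hA, Measure.prod_apply_symm hA,
      lintegral_prod_symm' _ (measurable_measure_prodMk_right hA),
      ← lintegral_const_mul' _ _ ENNReal.ofReal_ne_top]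
    refine lintegral_congr fun B => ?_
    have hm := measurable_coverWeight s B
    have hm' := measurable_coverWeight (s + h) B
    have hinner : ∀ w : ℝ × ℝ, (frechetIntensity.prod volume)
        ((fun x => (x, (w, B))) ⁻¹' exceedanceSet C s h x₁ x₂)
        = ∫⁻ c, ENNReal.ofReal (max (max (C / x₁ * coverWeight s B c * w.1)
          (C / x₂ * coverWeight (s + h) B c * w.2)) 0) := fun w => by
      rw [Measure.prod_apply_symm (measurable_prodMk_right hA)]
      exact lintegral_congr fun c => frechetIntensity_exceedanceSet hC h₁ h₂ s h w B c
    simp only [hinner]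
    rw [lintegral_lintegral_swap (by fun_prop),
      ← lintegral_const_mul' _ _ ENNReal.ofReal_ne_top]
    refine lintegral_congr fun c => ?_
    have hp := hcw s B c
    have hq := hcw (s + h) B c
    rw [hμ.lintegral_max hR2 (by positivity) (by positivity), ENNReal.ofReal_mul (by positivity)]
  rw [hmean, ← mul_add, ← lintegral_const_mul' _ _ ENNReal.ofReal_ne_top,
    ← lintegral_const_mul' _ _ ENNReal.ofReal_ne_top,
    ← lintegral_add_right _ ((measurable_overlapVolume h).const_mul _)]
  congr 1
  exact lintegral_congr fun B => lintegral_coverWeight hC h₁ h₂ hR1 s h B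

end Exceedance

/-! ### The pair law of the truncated extremal Gaussian process -/

lemma tegRoot_const_div {R C x₁ x₂ : ℝ} (hC : 0 ≤ C) (h₁ : 0 < x₁) (h₂ : 0 < x₂) :
    tegRoot R (C / x₁) (C / x₂) = C * (tegRoot R x₁ x₂ / (x₁ * x₂)) := by
  unfold tegRoot
  rw [show (C / x₁) ^ 2 - 2 * R * (C / x₁) * (C / x₂) + (C / x₂) ^ 2
      = (C / (x₁ * x₂)) ^ 2 * (x₁ ^ 2 - 2 * R * x₁ * x₂ + x₂ ^ 2) by field_simp; ring,
    Real.sqrt_mul (sq_nonneg _), Real.sqrt_sq (by positivity)]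
  ring

section Representation

variable {d : ℕ} {Ω : Type*} [MeasurableSpace Ω] {P : Measure Ω} [IsProbabilityMeasure P]
  {X : EuclideanSpace ℝ (Fin d) → Ω → ℝ} {ρ : EuclideanSpace ℝ (Fin d) → ℝ}
  {ξ : ℕ → Ω → ℝ} {c : ℕ → Ω → EuclideanSpace ℝ (Fin d)}
  {W : ℕ → EuclideanSpace ℝ (Fin d) → Ω → ℝ}
  {B : ℕ → Ω → TopologicalSpace.Compacts (EuclideanSpace ℝ (Fin d))}

lemma IsTruncatedExtremalGaussian.isStdGaussianPair
    (H : IsTruncatedExtremalGaussian P X ρ ξ c W B) (s h : EuclideanSpace ℝ (Fin d)) (i : ℕ) :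
    IsStdGaussianPair (P.map fun ω => (W i s ω, W i (s + h) ω)) (ρ h) := by
  refine isStdGaussianPair_map (H.measurable_W i s) (H.measurable_W i _)
    (H.gaussian_W i).hasGaussianLaw_prodMk (H.mean_W i s) (H.mean_W i _) ?_ ?_ ?_
  · rw [H.cov_W, sub_self, H.var_W]
  · rw [H.cov_W, sub_self, H.var_W]
  · rw [H.cov_W, add_sub_cancel_left]

lemma IsTruncatedExtremalGaussian.abs_correlation_le_one
    (H : IsTruncatedExtremalGaussian P X ρ ξ c W B) (h : EuclideanSpace ℝ (Fin d)) :
    |ρ h| ≤ 1 := by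
  have h1 : ∀ t, covariance (W 0 t) (W 0 t) P = 1 := fun t => by rw [H.cov_W, sub_self, H.var_W]
  have := abs_covariance_le_one ((H.gaussian_W 0).hasGaussianLaw_eval 0).memLp_two
    ((H.gaussian_W 0).hasGaussianLaw_eval h).memLp_two (h1 0) (h1 h)
  rwa [H.cov_W, sub_zero] at this

/-- The intensity of exceedances for the normalizing constant `√(2π) / 𝔼|B|` is the exponent
function of the model. -/
lemma lintegral_exceedanceSet_eq_tegExponent {μ : Measure (ℝ × ℝ)} [IsProbabilityMeasure μ]
    {R : ℝ} (hμ : IsStdGaussianPair μ R) (hR1 : -1 ≤ R) (hR2 : R ≤ 1)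
    {B : Ω → TopologicalSpace.Compacts (EuclideanSpace ℝ (Fin d))} (hB : Measurable B)
    (hpos : meanVolume P B ≠ 0) (hfin : meanVolume P B ≠ ∞) {x₁ x₂ : ℝ} (h₁ : 0 < x₁)
    (h₂ : 0 < x₂) (s h : EuclideanSpace ℝ (Fin d)) :
    ∫⁻ p, (μ.prod (P.map B)) (Prod.mk p ⁻¹'
        exceedanceSet (√(2 * Real.pi) / (meanVolume P B).toReal) s h x₁ x₂)
        ∂(frechetIntensity.prod volume)
      = ENNReal.ofReal (tegExponent (overlapRatio P B h) R x₁ x₂) := by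
  have := Measure.isProbabilityMeasure_map (μ := P) hB.aemeasurable
  set m := (meanVolume P B).toReal with hm
  have hm0 : 0 < m := ENNReal.toReal_pos hpos hfin
  set C := √(2 * Real.pi) / m with hCdef
  have hC : 0 ≤ C := by positivity
  have hO : ∫⁻ B', overlapVolume h B' ∂(P.map B) = ∫⁻ ω, overlapVolume h (B ω) ∂P :=
    lintegral_map (measurable_overlapVolume h) hB
  have hV : ∫⁻ B' : TopologicalSpace.Compacts (EuclideanSpace ℝ (Fin d)),
      volume (B' : Set (EuclideanSpace ℝ (Fin d))) ∂(P.map B) = meanVolume P B :=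
    lintegral_map measurable_volume_compacts hB
  have hOfin : ∫⁻ ω, overlapVolume h (B ω) ∂P ≠ ∞ :=
    ne_top_of_le_ne_top hfin (lintegral_mono fun ω => overlapVolume_le h (B ω))
  have key := lintegral_exceedanceSet hμ hR1 hR2 (P.map B) hC h₁ h₂ s h
  rw [hO, hV] at key
  set I := ∫⁻ p, (μ.prod (P.map B)) (Prod.mk p ⁻¹' exceedanceSet C s h x₁ x₂)
    ∂(frechetIntensity.prod volume) with hI
  set O := ∫⁻ ω, overlapVolume h (B ω) ∂P with hOdef
  have hrhs : ENNReal.ofReal (√(2 / Real.pi) / 4) *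
      (ENNReal.ofReal (2 * (C / x₁ + C / x₂)) * meanVolume P B) ≠ ∞ :=
    ENNReal.mul_ne_top ENNReal.ofReal_ne_top (ENNReal.mul_ne_top ENNReal.ofReal_ne_top hfin)
  have hIfin : I ≠ ∞ := ne_top_of_le_ne_top hrhs (key ▸ le_self_add)
  have hle : 0 ≤ C / x₁ + C / x₂ - tegRoot R (C / x₁) (C / x₂) :=
    sub_nonneg.2 (tegRoot_le_add hR1 (by positivity) (by positivity))
  have hreal := congrArg ENNReal.toReal key
  rw [ENNReal.toReal_add hIfin (ENNReal.mul_ne_top ENNReal.ofReal_ne_top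
    (ENNReal.mul_ne_top ENNReal.ofReal_ne_top hOfin)), ENNReal.toReal_mul, ENNReal.toReal_mul,
    ENNReal.toReal_mul, ENNReal.toReal_mul, ENNReal.toReal_ofReal (by positivity),
    ENNReal.toReal_ofReal hle, ENNReal.toReal_ofReal (by positivity), ← hm,
    tegRoot_const_div hC h₁ h₂] at hreal
  have hratio : overlapRatio P B h = O.toReal / m := rfl
  -- the constant of the Gaussian mean cancels the normalization
  have hcancel : √(2 / Real.pi) * C = 2 / m := by
    rw [hCdef, ← mul_div_assoc, ← Real.sqrt_mul (by positivity),
      show 2 / Real.pi * (2 * Real.pi) = 2 ^ 2 by field_simp,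
      Real.sqrt_sq zero_le_two]
  rw [← ENNReal.ofReal_toReal hIfin]
  congr 1
  rw [tegExponent_eq h₁ h₂, hratio]
  have e1 : √(2 / Real.pi) / 4 * (2 * (C / x₁ + C / x₂) * m) = 1 / x₁ + 1 / x₂ := by
    rw [show √(2 / Real.pi) / 4 * (2 * (C / x₁ + C / x₂) * m)
      = (√(2 / Real.pi) * C) * (m / 2) * (1 / x₁ + 1 / x₂) by ring, hcancel]
    field_simp
  have e2 : √(2 / Real.pi) / 4 * ((C / x₁ + C / x₂ - C * (tegRoot R x₁ x₂ / (x₁ * x₂)))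
      * O.toReal) = O.toReal / m / 2 * (1 / x₁ + 1 / x₂ - tegRoot R x₁ x₂ / (x₁ * x₂)) := by
    rw [show √(2 / Real.pi) / 4 * ((C / x₁ + C / x₂ - C * (tegRoot R x₁ x₂ / (x₁ * x₂)))
      * O.toReal) = (√(2 / Real.pi) * C) * (O.toReal / 4)
        * (1 / x₁ + 1 / x₂ - tegRoot R x₁ x₂ / (x₁ * x₂)) by ring, hcancel]
    ring
  rw [e1, e2] at hreal
  linarith

/-- The pairs of the truncated extremal Gaussian process have the truncated extremal Gaussian
law: `X s ≤ x₁` and `X (s + h) ≤ x₂` means that no marked point falls into the exceedance set. -/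
theorem IsTruncatedExtremalGaussian.hasTEGPairLaw
    (H : IsTruncatedExtremalGaussian P X ρ ξ c W B) (s h : EuclideanSpace ℝ (Fin d)) :
    HasTEGPairLaw P (X s) (X (s + h)) (overlapRatio P (B 0) h) (ρ h) := by
  set C := √(2 * Real.pi) / (meanVolume P (B 0)).toReal with hC
  have hspec : ∀ t, ∀ᵐ ω ∂P,
      IsLUB (range fun i => tegSpectral C t (ξ i ω, c i ω) (W i t ω) (B i ω)) (X t ω) :=
    fun t => H.spectral t
  have hmeas : ∀ t i, Measurable fun ω => tegSpectral C t (ξ i ω, c i ω) (W i t ω) (B i ω) :=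
    fun t i => (measurable_tegSpectral C t).comp
      ((H.poisson.measurable i).prodMk ((H.measurable_W i t).prodMk (H.measurable_B i)))
  have hXm : ∀ t, AEMeasurable (X t) P := fun t =>
    AEMeasurable.isLUB (fun i => (hmeas t i).aemeasurable) (hspec t)
  obtain ⟨hR1, hR2⟩ := abs_le.1 (H.abs_correlation_le_one h)
  have hα := overlapRatio_mem_Icc (B 0) h H.meanVolume_finite
  refine ⟨hXm s, hXm (s + h), fun x₁ x₂ h₁ h₂ => ?_⟩
  have hWm : ∀ i, Measurable fun ω => (W i s ω, W i (s + h) ω) := fun i =>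
    (H.measurable_W i s).prodMk (H.measurable_W i _)
  have hWp := fun i => Measure.isProbabilityMeasure_map (μ := P) (hWm i).aemeasurable
  -- evaluation of the paths at the two sites
  let ev : (EuclideanSpace ℝ (Fin d) → ℝ) → ℝ × ℝ := fun f => (f s, f (s + h))
  have hev : Measurable ev := by fun_prop
  have hevs : Measurable fun f : ℕ → EuclideanSpace ℝ (Fin d) → ℝ => fun i => ev (f i) := by
    fun_prop
  have hI := lintegral_exceedanceSet_eq_tegExponent (H.isStdGaussianPair s h 0) hR1 hR2
    (H.measurable_B 0) H.meanVolume_pos H.meanVolume_finite h₁ h₂ s h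
  have hvoid := H.poisson.measure_forall_notMem_marked
    (U := fun i ω => (W i s ω, W i (s + h) ω)) (V := B) hWm H.measurable_B
    (fun i => (H.isStdGaussianPair s h i).unique (H.isStdGaussianPair s h 0))
    (fun i => (H.identDistrib_B i).map_eq)
    (H.indep_W.comp (fun _ => ev) fun _ => hev) H.indep_B
    (H.indep_W_B.comp hevs measurable_id)
    (H.indep_points.comp measurable_id (hevs.prodMap measurable_id))
    (measurableSet_exceedanceSet C s h x₁ x₂) (hI ▸ ENNReal.ofReal_ne_top)
  have hnonneg : 0 ≤ tegExponent (overlapRatio P (B 0) h) (ρ h) x₁ x₂ :=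
    (half_le_tegExponent hα.1 hα.2 h₁ h₂).trans' (by positivity)
  rw [hI, expNeg_ofReal hnonneg] at hvoid
  rw [← hvoid]
  refine measure_congr ?_
  filter_upwards [hspec s, hspec (s + h)] with ω hω hω'
  refine propext ?_
  change (X s ω ≤ x₁ ∧ X (s + h) ω ≤ x₂) ↔ _
  rw [isLUB_le_iff hω, isLUB_le_iff hω', mem_upperBounds, mem_upperBounds, forall_mem_range,
    forall_mem_range, ← forall_and]
  refine forall_congr' fun i => ?_
  simp only [exceedanceSet, mem_ofPred_eq, not_or, not_lt]

end Representation

end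

theorem corollary4p3 {d : ℕ} {Ω : Type*} [MeasurableSpace Ω] (P : Measure Ω)
    [IsProbabilityMeasure P] (X : EuclideanSpace ℝ (Fin d) → Ω → ℝ)
    (ρ : EuclideanSpace ℝ (Fin d) → ℝ) (ν : ℝ) (hν0 : 0 < ν) (hν1 : ν < 1 / 2)
    (s h : EuclideanSpace ℝ (Fin d)) :
    -- the model given by its pairwise laws, with `α(h) = {1 - ‖h‖ / (2 r)}₊`
    (∀ r : ℝ, 0 < r → -1 ≤ ρ h → ρ h ≤ 1 → (ρ h = 1 → truncProfile r ‖h‖ = 0) →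
      HasTEGPairLaw P (X s) (X (s + h)) (truncProfile r ‖h‖) (ρ h) →
      HasTEGCovariance P (X s) (X (s + h)) (truncProfile r ‖h‖) (ρ h) ν) ∧
    -- the model given by its spectral representation, with `α(h) = 𝔼|B ∩ (h + B)| / 𝔼|B|`
    (∀ (ξ : ℕ → Ω → ℝ) (c : ℕ → Ω → EuclideanSpace ℝ (Fin d))
      (W : ℕ → EuclideanSpace ℝ (Fin d) → Ω → ℝ)
      (B : ℕ → Ω → TopologicalSpace.Compacts (EuclideanSpace ℝ (Fin d))),
      IsTruncatedExtremalGaussian P X ρ ξ c W B →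
      HasTEGPairLaw P (X s) (X (s + h)) (overlapRatio P (B 0) h) (ρ h) ∧
      ((ρ h = 1 → overlapRatio P (B 0) h = 0) →
        HasTEGCovariance P (X s) (X (s + h)) (overlapRatio P (B 0) h) (ρ h) ν) ∧
      (d = 1 → ∀ r : ℝ, 0 < r →
        (∀ᵐ ω ∂P, (B 0 ω : Set (EuclideanSpace ℝ (Fin d))) = Metric.closedBall 0 r) →
        overlapRatio P (B 0) h = truncProfile r ‖h‖)) := by
  refine ⟨fun r hr hR1 hR2 hRa hlaw => ?_, fun ξ c W B H => ⟨H.hasTEGPairLaw s h, ?_, ?_⟩⟩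
  · have hα := truncProfile_mem_Icc hr (norm_nonneg h)
    exact hlaw.hasTEGCovariance hν1 hα.1 hα.2 hR1 hR2 hRa
  · intro hRa
    obtain ⟨hR1, hR2⟩ := abs_le.1 (H.abs_correlation_le_one h)
    have hα := overlapRatio_mem_Icc (B 0) h H.meanVolume_finite
    exact (H.hasTEGPairLaw s h).hasTEGCovariance hν1 hα.1 hα.2 hR1 hR2 hRa
  · rintro rfl r hr hB
    exact overlapRatio_closedBall hr h hB
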